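/- Write $\widehat f(\xi)=(2\pi)^{-n/2}\int_{\mathbb R^n}e^{-ix\cdot\xi}f(x)\,dx$ for the Fourier transform, extended by duality to the tempered distributions $\mathcal S'(\mathbb R^n)$. For $z\in\mathbb C$ with $\operatorname{Re}z\ge0$ let $e^{z\Delta}$ be the operator on $\mathcal S'(\mathbb R^n)$ given by $\widehat{e^{z\Delta}u}=e^{-z|\xi|^2}\,\widehat u$ (so $e^{it\Delta}$, $t\in\mathbb R$, is the free Schrödinger group and $e^{\delta\Delta}$, $\delta>0$, the heat semigroup). For $a>0$, $u\in L^2(e^{a|x|^2}dx)$ means that the distribution $u$ is given by a function with $\int_{\mathbb R^n}|u(x)|^2e^{a|x|^2}dx<\infty$. Theorem 1.1. Let $u_0\in\mathcal S'(\mathbb R^n)$ and let $\tau\in\mathbb R$ be arbitrary. The following seven statements are equivalent: (i) There are two different real numbers $t_1,t_2$ and numbers $a_1,a_2>0$ such that $e^{it_j\Delta}u_0\in L^2(e^{a_j|x|^2}dx)$ for $j=1,2$. (ii) There are $b_1,b_2>0$ such that $u_0\in L^2(e^{b_1|x|^2}dx)$ and $\widehat{u_0}\in L^2(e^{b_2|x|^2}dx)$.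 (iii) There is a function $\nu:[0,+\infty)\to(0,+\infty)$ such that $e^{it\Delta}u_0\in L^2(e^{\nu(t)|x|^2}dx)$ for all $t\ge0$. (iv) The distribution $g(x)=e^{i\tau|x|^2}u_0(x)$ satisfies (ii), with possibly different constants $b_1,b_2>0$. (v) $u_0$ is the restriction to $\mathbb R^n$ of an entire function on $\mathbb C^n$, again denoted $u_0$, such that $|u_0(x+iy)|\le Ne^{-a|x|^2+b|y|^2}$ for all $x,y\in\mathbb R^n$ and some constants $N,a,b>0$. (vi) $\widehat{u_0}$ satisfies (v), with possibly different constants $N,a,b>0$. (vii) There are $\delta,\epsilon>0$ and $h\in L^2(e^{\epsilon|x|^2}dx)$ such that $u_0=e^{\delta\Delta}h$. -/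

import Mathlib

open MeasureTheory
open scoped SchwartzMap FourierTransform NNReal ContDiff

noncomputable section

namespace GaussianDecay

/-- The function `x ↦ exp (c |x|²)` on `ℝⁿ`, where `c` is a complex number. -/
def gaussian {n : ℕ} (c : ℂ) (x : EuclideanSpace ℝ (Fin n)) : ℂ :=
  Complex.exp (c * ((‖x‖ ^ 2 : ℝ) : ℂ))

/-- For `Re c ≤ 0` the function `exp (c |x|²)` is smooth with polynomially bounded derivatives, so
that multiplying a tempered distribution by it makes sense. -/
theorem hasTemperateGrowth_gaussian {n : ℕ} {c : ℂ} (hc : c.re ≤ 0) :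
    (gaussian c : EuclideanSpace ℝ (Fin n) → ℂ).HasTemperateGrowth := by
  have hsm : ContDiff ℝ ∞ (fun s : ℝ ↦ Complex.exp (c * (s : ℂ))) := by
    have : ContDiff ℝ ∞ (fun s : ℝ ↦ (s : ℂ)) := Complex.ofRealCLM.contDiff
    fun_prop
  have hder : ∀ k : ℕ, iteratedDeriv k (fun s : ℝ ↦ Complex.exp (c * (s : ℂ))) =
      fun s : ℝ ↦ c ^ k * Complex.exp (c * (s : ℂ)) := by
    intro k
    induction k with
    | zero => simp
    | succ k ih =>
      rw [iteratedDeriv_succ, ih]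
      ext s
      have h1 : HasDerivAt (fun s : ℝ ↦ c * (s : ℂ)) c s := by
        simpa using (Complex.ofRealCLM.hasDerivAt (x := s)).const_mul c
      rw [((h1.cexp).const_mul (c ^ k)).deriv]
      ring
  refine Function.HasTemperateGrowth.comp' (D := EuclideanSpace ℝ (Fin n))
    (g := fun s : ℝ ↦ Complex.exp (c * (s : ℂ))) (f := fun x ↦ ‖x‖ ^ 2) (t := Set.Ici (0 : ℝ))
    ?_ (uniqueDiffOn_Ici 0) hsm.contDiffOn ?_ (Function.hasTemperateGrowth_norm_sq _)
  · rintro _ ⟨x, rfl⟩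
    exact sq_nonneg ‖x‖
  · intro N
    refine ⟨0, ∑ k ∈ Finset.range (N + 1), ‖c‖ ^ k, by positivity, fun k hk s hs ↦ ?_⟩
    rw [iteratedFDerivWithin_eq_iteratedFDeriv (uniqueDiffOn_Ici 0)
      (hsm.contDiffAt.of_le (mod_cast le_top)) hs, norm_iteratedFDeriv_eq_norm_iteratedDeriv, hder]
    have h2 : ‖Complex.exp (c * (s : ℂ))‖ ≤ 1 := by
      rw [Complex.norm_exp]
      apply Real.exp_le_one_iff.2
      simpa using mul_nonpos_of_nonpos_of_nonneg hc hs
    have h3 : ‖c‖ ^ k ≤ ∑ k ∈ Finset.range (N + 1), ‖c‖ ^ k :=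
      Finset.single_le_sum (f := fun k ↦ ‖c‖ ^ k) (fun i _ ↦ by positivity)
        (Finset.mem_range.2 (by omega))
    rw [norm_mul, norm_pow, pow_zero, mul_one]
    calc ‖c‖ ^ k * ‖Complex.exp (c * (s : ℂ))‖ ≤ ‖c‖ ^ k * 1 := by gcongr
      _ ≤ _ := by rw [mul_one]; exact h3

/-- The dilation `x ↦ (2π)⁻¹ x` of `ℝⁿ`. -/
def dilation (n : ℕ) : EuclideanSpace ℝ (Fin n) ≃L[ℝ] EuclideanSpace ℝ (Fin n) :=
  ContinuousLinearEquiv.smulLeft (Units.mk0 ((2 * Real.pi)⁻¹ : ℝ) (by positivity))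

/-- The Fourier transform of Schwartz functions in the normalization
`φ ↦ (2π)^(-n/2) ∫ exp (-i x·ξ) φ(x) dx`, see `schwartzFourier_apply`. -/
def schwartzFourier (n : ℕ) :
    𝓢(EuclideanSpace ℝ (Fin n), ℂ) →L[ℂ] 𝓢(EuclideanSpace ℝ (Fin n), ℂ) :=
  (((2 * Real.pi) ^ (-(n : ℝ) / 2) : ℝ) : ℂ) •
    (SchwartzMap.compCLMOfContinuousLinearEquiv ℂ (dilation n) ∘L
      FourierTransform.fourierCLM ℂ 𝓢(EuclideanSpace ℝ (Fin n), ℂ))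

theorem schwartzFourier_apply {n : ℕ} (φ : 𝓢(EuclideanSpace ℝ (Fin n), ℂ))
    (ξ : EuclideanSpace ℝ (Fin n)) :
    schwartzFourier n φ ξ = (((2 * Real.pi) ^ (-(n : ℝ) / 2) : ℝ) : ℂ) *
      ∫ x, Complex.exp (-Complex.I * ((inner ℝ x ξ : ℝ) : ℂ)) * φ x := by
  have h : schwartzFourier n φ ξ = (((2 * Real.pi) ^ (-(n : ℝ) / 2) : ℝ) : ℂ) *
    (𝓕 φ) ((2 * Real.pi)⁻¹ • ξ) := rfl
  rw [h, SchwartzMap.fourier_coe, Real.fourier_eq']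
  congr 1
  refine integral_congr_ae (Filter.Eventually.of_forall fun x ↦ ?_)
  simp only [inner_smul_right, smul_eq_mul]
  congr 2
  have := Real.pi_ne_zero
  push_cast
  field_simp

/-- The Fourier transform `û` of a tempered distribution `u`, in the normalization
`û(ξ) = (2π)^(-n/2) ∫ exp (-i x·ξ) u(x) dx`, defined by duality: `û(φ) = u(φ̂)`. -/
def fourier {n : ℕ} (u : TemperedDistribution (EuclideanSpace ℝ (Fin n)) ℂ) :
    TemperedDistribution (EuclideanSpace ℝ (Fin n)) ℂ :=
  PointwiseConvergenceCLM.precomp ℂ (schwartzFourier n) u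

theorem fourier_apply {n : ℕ} (u : TemperedDistribution (EuclideanSpace ℝ (Fin n)) ℂ)
    (φ : 𝓢(EuclideanSpace ℝ (Fin n), ℂ)) : fourier u φ = u (schwartzFourier n φ) := rfl

/-- The product `exp (c |x|²) u` for a tempered distribution `u`, used for `Re c ≤ 0`. -/
def mulGaussian {n : ℕ} (c : ℂ) (u : TemperedDistribution (EuclideanSpace ℝ (Fin n)) ℂ) :
    TemperedDistribution (EuclideanSpace ℝ (Fin n)) ℂ :=
  TemperedDistribution.smulLeftCLM ℂ (gaussian c) u

/-- The operator `exp (z Δ)` on tempered distributions, used for `Re z ≥ 0`: the Schrödinger group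
for `z = i t` and the heat semigroup for `z = δ > 0`. It is the Fourier multiplier with symbol
`exp (-z |ξ|²)`, see `fourier_expLaplacian`; in Mathlib's normalization of the Fourier transform
this symbol reads `exp (-z |2πξ|²)`. -/
def expLaplacian {n : ℕ} (z : ℂ) (u : TemperedDistribution (EuclideanSpace ℝ (Fin n)) ℂ) :
    TemperedDistribution (EuclideanSpace ℝ (Fin n)) ℂ :=
  TemperedDistribution.fourierMultiplierCLM ℂ
    (fun ξ ↦ gaussian (-z) ((2 * Real.pi) • ξ)) u

theorem dilation_symm_apply {n : ℕ} (x : EuclideanSpace ℝ (Fin n)) :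
    (dilation n).symm x = (2 * Real.pi) • x := by
  rw [ContinuousLinearEquiv.symm_apply_eq]
  change x = (2 * Real.pi)⁻¹ • (2 * Real.pi) • x
  rw [smul_smul, inv_mul_cancel₀ (by positivity), one_smul]

theorem schwartzFourier_eq {n : ℕ} (φ : 𝓢(EuclideanSpace ℝ (Fin n), ℂ)) :
    schwartzFourier n φ =
      (((2 * Real.pi) ^ (-(n : ℝ) / 2) * (2 * Real.pi) ^ n : ℝ) : ℂ) •
        𝓕 (SchwartzMap.compCLMOfContinuousLinearEquiv ℂ (dilation n).symm φ) := by
  ext ξ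
  have h1 : schwartzFourier n φ ξ = (((2 * Real.pi) ^ (-(n : ℝ) / 2) : ℝ) : ℂ) *
    (𝓕 φ) ((2 * Real.pi)⁻¹ • ξ) := rfl
  rw [h1, smul_apply, SchwartzMap.fourier_coe, SchwartzMap.fourier_coe,
    Real.fourier_eq', Real.fourier_eq', smul_eq_mul, Complex.ofReal_mul, mul_assoc]
  congr 1
  have h2 := Measure.integral_comp_smul (volume : Measure (EuclideanSpace ℝ (Fin n)))
    (fun v ↦ Complex.exp (((-2 * Real.pi * inner ℝ v ((2 * Real.pi)⁻¹ • ξ) : ℝ) : ℂ) *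
      Complex.I) • φ v) (2 * Real.pi)
  have h3 : ∀ v : EuclideanSpace ℝ (Fin n),
      inner ℝ ((2 * Real.pi) • v) ((2 * Real.pi)⁻¹ • ξ) = inner ℝ v ξ := by
    intro v
    rw [real_inner_smul_left, real_inner_smul_right, ← mul_assoc,
      mul_inv_cancel₀ (by positivity), one_mul]
  simp only [h3, finrank_euclideanSpace, Fintype.card_fin] at h2
  have h4 : ∀ v, SchwartzMap.compCLMOfContinuousLinearEquiv ℂ (dilation n).symm φ v =
      φ ((2 * Real.pi) • v) := fun v ↦ by rw [← dilation_symm_apply]; rfl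
  simp only [h4]
  rw [h2, abs_of_pos (by positivity), ← Complex.coe_smul, smul_eq_mul, ← mul_assoc,
    ← Complex.ofReal_mul, mul_inv_cancel₀ (by positivity), Complex.ofReal_one, one_mul]

theorem fourier_expLaplacian {n : ℕ} {z : ℂ} (hz : 0 ≤ z.re)
    (u : TemperedDistribution (EuclideanSpace ℝ (Fin n)) ℂ) :
    fourier (expLaplacian z u) = mulGaussian (-z) (fourier u) := by
  have hg : (gaussian (-z) : EuclideanSpace ℝ (Fin n) → ℂ).HasTemperateGrowth :=
    hasTemperateGrowth_gaussian (by simpa using hz)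
  have hg' : (fun ξ : EuclideanSpace ℝ (Fin n) ↦
      gaussian (-z) ((2 * Real.pi) • ξ)).HasTemperateGrowth :=
    hg.comp (((2 * Real.pi) • ContinuousLinearMap.id ℝ
      (EuclideanSpace ℝ (Fin n))).hasTemperateGrowth)
  ext φ
  rw [fourier_apply, expLaplacian, TemperedDistribution.fourierMultiplierCLM_apply_apply,
    mulGaussian, TemperedDistribution.smulLeftCLM_apply_apply, fourier_apply,
    schwartzFourier_eq, schwartzFourier_eq, FourierTransform.fourierInv_smul,
    FourierTransform.fourierInv_fourier_eq, map_smul, FourierTransform.fourier_smul]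
  congr 3
  ext x
  have h5 : ∀ (ψ : 𝓢(EuclideanSpace ℝ (Fin n), ℂ)) v,
      SchwartzMap.compCLMOfContinuousLinearEquiv ℂ (dilation n).symm ψ v =
        ψ ((2 * Real.pi) • v) := fun ψ v ↦ by rw [← dilation_symm_apply]; rfl
  rw [h5, SchwartzMap.smulLeftCLM_apply_apply hg', SchwartzMap.smulLeftCLM_apply_apply hg, h5]

/-- The tempered distribution `u` is the function `f`: `u(φ) = ∫ φ f` for Schwartz `φ`. -/
def IsFunction {n : ℕ} (u : TemperedDistribution (EuclideanSpace ℝ (Fin n)) ℂ)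
    (f : EuclideanSpace ℝ (Fin n) → ℂ) : Prop :=
  ∀ φ : 𝓢(EuclideanSpace ℝ (Fin n), ℂ),
    Integrable (fun x ↦ φ x * f x) volume ∧ u φ = ∫ x, φ x * f x

/-- `u ∈ L²(exp (a |x|²) dx)`. -/
def MemGaussianL2 {n : ℕ} (a : ℝ) (u : TemperedDistribution (EuclideanSpace ℝ (Fin n)) ℂ) :
    Prop :=
  ∃ f : EuclideanSpace ℝ (Fin n) → ℂ,
    MemLp f 2 (volume.withDensity fun x ↦ ENNReal.ofReal (Real.exp (a * ‖x‖ ^ 2))) ∧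
      IsFunction u f

/-- The point `x + i y` of `ℂⁿ`. -/
def complexPoint {n : ℕ} (x y : EuclideanSpace ℝ (Fin n)) : EuclideanSpace ℂ (Fin n) :=
  WithLp.toLp 2 fun j ↦ (x j : ℂ) + Complex.I * (y j : ℂ)

/-- `u` and its Fourier transform both have Gaussian decay in the `L²` sense. -/
def HasGaussianDecay {n : ℕ} (u : TemperedDistribution (EuclideanSpace ℝ (Fin n)) ℂ) : Prop :=
  ∃ b₁ b₂ : ℝ, 0 < b₁ ∧ 0 < b₂ ∧ MemGaussianL2 b₁ u ∧ MemGaussianL2 b₂ (fourier u)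

/-- `u` is the restriction to `ℝⁿ` of an entire function `F` on `ℂⁿ` such that
`|F(x + i y)| ≤ N exp (-a |x|² + b |y|²)` for some constants `N, a, b > 0`. -/
def HasGaussianExtension {n : ℕ} (u : TemperedDistribution (EuclideanSpace ℝ (Fin n)) ℂ) :
    Prop :=
  ∃ F : EuclideanSpace ℂ (Fin n) → ℂ, Differentiable ℂ F ∧
    IsFunction u (fun x ↦ F (complexPoint x 0)) ∧
    ∃ N a b : ℝ, 0 < N ∧ 0 < a ∧ 0 < b ∧ ∀ x y : EuclideanSpace ℝ (Fin n),
      ‖F (complexPoint x y)‖ ≤ N * Real.exp (-a * ‖x‖ ^ 2 + b * ‖y‖ ^ 2)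

end GaussianDecay

end

/-! Every statement is tied to (v), because the functions in (v) form a class stable under all the
operations involved. Multiplication by `exp (c z²)` preserves it as long as `Re c` is below the
decay rate (`gaussianBound_exp_mul`). The Fourier transform preserves it as well: moving the domain
of integration to `ℝⁿ - iεξ` gives decay (`fourierLaplace_decay`), and decay of the function gives
an entire transform. Hence every `exp (zΔ)` with `Re z ≥ 0` preserves it.

For the converse directions, Gaussian decay of `u` makes `û` entire with growth `exp (b|η|²)` at `ξ
+ iη`. By the maximum principle, such a function has the bound of (v) as soon as it decays like a
Gaussian on `ℝⁿ` (`gaussian_bound_of_real_decay`). Only real decay of `û` is then needed. In (ii) it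
is given in `L²` and made pointwise by a Lipschitz estimate. In (vii) the heat factor supplies it.

In (i) it comes from uniqueness in the style of Hardy's theorem. The transforms of the two solutions
differ by a factor `exp (iκξ²)`, `κ ≠ 0`, whose modulus at `x + iy` is `exp (-2κ x·y)`. As both
products grow only like `exp (b|y|²)`, the transform is small on one side of `ℝⁿ`, and the maximum
principle on a small square carries a part of that gain to `ℝⁿ` itself
(`real_decay_of_chirp_bound`). -/

namespace GaussianDecay

/-! ### Comparison with harmonic quadratics on a rectangle. -/

section MaximumPrinciple

/-- The maximum principle on a rectangle, for an entire function compared with the exponential of a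
harmonic quadratic polynomial. -/
theorem norm_le_exp_quadratic_of_rectangle {f : ℂ → ℂ} (hf : Differentiable ℂ f)
    {r t₀ t₁ N α β γ : ℝ} (hr : 0 < r) (ht : t₀ < t₁)
    (hb : ∀ s ∈ Set.Icc (-r) r, ∀ t ∈ Set.Icc t₀ t₁, (s = -r ∨ s = r ∨ t = t₀ ∨ t = t₁) →
      ‖f (s + t * Complex.I)‖ ≤ N * Real.exp (α + β * t + γ * (s ^ 2 - t ^ 2)))
    {t : ℝ} (htt : t ∈ Set.Icc t₀ t₁) :
    ‖f (t * Complex.I)‖ ≤ N * Real.exp (α + β * t - γ * t ^ 2) := by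
  -- The real part of `Q` is minus the exponent of the bound, so `f * exp Q` has modulus at most `N`
  -- on the boundary.
  set Q : ℂ → ℂ := fun z ↦ -(α - Complex.I * β * z + γ * z ^ 2) with hQ
  have hQre : ∀ s t : ℝ, (Q (s + t * Complex.I)).re = -(α + β * t + γ * (s ^ 2 - t ^ 2)) := by
    intro s t
    simp [hQ, pow_two]
    ring
  have hg : Differentiable ℂ fun z ↦ f z * Complex.exp (Q z) := by fun_prop
  have hnorm : ∀ s t : ℝ, ‖f (s + t * Complex.I) * Complex.exp (Q (s + t * Complex.I))‖ =
      ‖f (s + t * Complex.I)‖ * Real.exp (-(α + β * t + γ * (s ^ 2 - t ^ 2))) := by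
    intro s t
    rw [norm_mul, Complex.norm_exp, hQre]
  have hr' : -r < r := by linarith
  have key := Complex.norm_le_of_forall_mem_frontier_norm_le
    (U := Set.Ioo (-r) r ×ℂ Set.Ioo t₀ t₁) (f := fun z ↦ f z * Complex.exp (Q z)) (C := N)
    ((Metric.isBounded_Ioo _ _).reProdIm (Metric.isBounded_Ioo _ _)) hg.diffContOnCl ?_
    (z := t * Complex.I) ?_
  · have h := hnorm 0 t
    simp only [Complex.ofReal_zero, zero_add] at h
    rw [h, Real.exp_neg, ← div_eq_mul_inv, div_le_iff₀ (Real.exp_pos _)] at key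
    have e : α + β * t + γ * (0 ^ 2 - t ^ 2) = α + β * t - γ * t ^ 2 := by ring
    rwa [e] at key
  · intro z hz
    rw [Complex.frontier_reProdIm, closure_Ioo hr'.ne, closure_Ioo ht.ne, frontier_Ioo hr',
      frontier_Ioo ht] at hz
    have h := hnorm z.re z.im
    rw [Complex.re_add_im] at h
    rw [h, Real.exp_neg, ← div_eq_mul_inv, div_le_iff₀ (Real.exp_pos _)]
    have hb' := hb z.re
    rcases hz with ⟨h1, h2⟩ | ⟨h1, h2⟩
    · have h3 : z.im ∈ Set.Icc t₀ t₁ := by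
        rcases h2 with h2 | h2 <;> rw [Set.mem_preimage] at * <;> simp_all [ht.le]
      have := hb' h1 z.im h3 (by rcases h2 with h2 | h2 <;> simp_all)
      rwa [Complex.re_add_im] at this
    · have h3 : z.re ∈ Set.Icc (-r) r := by
        rcases h1 with h1 | h1 <;> rw [Set.mem_preimage] at * <;> simp_all [hr.le]
      have := hb' h3 z.im h2 (by rcases h1 with h1 | h1 <;> simp_all)
      rwa [Complex.re_add_im] at this
  · rw [Complex.closure_reProdIm, closure_Ioo hr'.ne, closure_Ioo ht.ne]
    exact ⟨by simp [hr.le], by simpa using htt⟩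

end MaximumPrinciple

/-! ### Real and imaginary coordinates on `ℂⁿ`. -/

section ComplexPoint

variable {n : ℕ}

theorem complexPoint_apply (x y : EuclideanSpace ℝ (Fin n)) (j : Fin n) :
    complexPoint x y j = (x j : ℂ) + Complex.I * (y j : ℂ) := rfl

/-- One-variable arguments are applied on slices with a real direction; this gives the coordinates
on them. -/
theorem complexPoint_add_smul (x y w : EuclideanSpace ℝ (Fin n)) (c : ℂ) :
    complexPoint x y + c • complexPoint w 0 = complexPoint (x + c.re • w) (y + c.im • w) := by
  ext j
  simp only [PiLp.add_apply, PiLp.smul_apply, complexPoint_apply, PiLp.zero_apply, smul_eq_mul]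
  conv_lhs => rw [← Complex.re_add_im c]
  push_cast
  ring

theorem exists_complexPoint_eq (z : EuclideanSpace ℂ (Fin n)) : ∃ x y, complexPoint x y = z :=
  ⟨WithLp.toLp 2 fun j ↦ (z j).re, WithLp.toLp 2 fun j ↦ (z j).im, by
    ext j
    simp [complexPoint_apply, mul_comm Complex.I, Complex.re_add_im]⟩

theorem continuous_complexPoint :
    Continuous fun p : EuclideanSpace ℝ (Fin n) × EuclideanSpace ℝ (Fin n) ↦
      complexPoint p.1 p.2 := by
  unfold complexPoint
  fun_prop

theorem norm_complexPoint_zero (x : EuclideanSpace ℝ (Fin n)) : ‖complexPoint x 0‖ = ‖x‖ := by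
  simp [EuclideanSpace.norm_eq, complexPoint_apply]

/-- The linear form `z ↦ ∑ⱼ xⱼ zⱼ` on `ℂⁿ`. -/
noncomputable def dotCLM (x : EuclideanSpace ℝ (Fin n)) : EuclideanSpace ℂ (Fin n) →L[ℂ] ℂ :=
  -- The conjugation in the first slot of the inner product is harmless, because this vector is
  -- real.
  innerSL ℂ (complexPoint x 0)

theorem dotCLM_complexPoint (x ξ η : EuclideanSpace ℝ (Fin n)) :
    dotCLM x (complexPoint ξ η) = ((inner ℝ x ξ : ℝ) : ℂ) + Complex.I * ((inner ℝ x η : ℝ) : ℂ) := by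
  simp only [dotCLM, innerSL_apply_apply, PiLp.inner_apply, RCLike.inner_apply,
    complexPoint_apply, PiLp.zero_apply, conj_trivial, Complex.ofReal_sum, Finset.mul_sum]
  rw [← Finset.sum_add_distrib]
  refine Finset.sum_congr rfl fun j _ ↦ ?_
  simp
  ring

theorem norm_dotCLM (x : EuclideanSpace ℝ (Fin n)) : ‖dotCLM x‖ = ‖x‖ := by
  rw [dotCLM, innerSL_apply_norm, norm_complexPoint_zero]

theorem continuous_dotCLM : Continuous (dotCLM : EuclideanSpace ℝ (Fin n) → _) :=
  (innerSL ℂ).continuous.comp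
    (continuous_complexPoint.comp (continuous_id.prodMk continuous_const))

/-- The quadratic form `z ↦ ∑ⱼ zⱼ²` on `ℂⁿ`. -/
noncomputable def sumSq (z : EuclideanSpace ℂ (Fin n)) : ℂ := ∑ j, z j ^ 2

theorem differentiable_sumSq : Differentiable ℂ (sumSq : EuclideanSpace ℂ (Fin n) → ℂ) := by
  unfold sumSq
  fun_prop

theorem sumSq_complexPoint (x y : EuclideanSpace ℝ (Fin n)) :
    sumSq (complexPoint x y) =
      ((‖x‖ ^ 2 - ‖y‖ ^ 2 : ℝ) : ℂ) + 2 * Complex.I * ((inner ℝ x y : ℝ) : ℂ) := by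
  rw [EuclideanSpace.real_norm_sq_eq, EuclideanSpace.real_norm_sq_eq, ← Finset.sum_sub_distrib,
    PiLp.inner_apply]
  simp only [sumSq, complexPoint_apply, RCLike.inner_apply, conj_trivial, Complex.ofReal_sum,
    Finset.mul_sum]
  rw [← Finset.sum_add_distrib]
  refine Finset.sum_congr rfl fun j _ ↦ ?_
  push_cast
  linear_combination ((y j : ℂ) ^ 2) * Complex.I_sq

theorem exp_sumSq_complexPoint_zero (c : ℂ) (x : EuclideanSpace ℝ (Fin n)) :
    Complex.exp (c * sumSq (complexPoint x 0)) = gaussian c x := by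
  rw [sumSq_complexPoint, gaussian]
  simp

/-- The cross term is the source of the uniqueness phenomenon: for imaginary `c` the factor is
unimodular on `ℝⁿ` but exponentially large or small off it, according to the sign of `x·y`. -/
theorem norm_exp_sumSq (c : ℂ) (x y : EuclideanSpace ℝ (Fin n)) :
    ‖Complex.exp (c * sumSq (complexPoint x y))‖ =
      Real.exp (c.re * (‖x‖ ^ 2 - ‖y‖ ^ 2) - 2 * c.im * inner ℝ x y) := by
  rw [Complex.norm_exp, sumSq_complexPoint]
  congr 1
  simp [-Complex.ofReal_pow]
  ring

/-- Entire functions of one variable that agree on the real line are equal. -/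
theorem eq_of_eq_ofReal {f g : ℂ → ℂ} (hf : Differentiable ℂ f) (hg : Differentiable ℂ g)
    (h : ∀ s : ℝ, f s = g s) : f = g := by
  refine AnalyticOnNhd.eq_of_frequently_eq (z₀ := 0) (fun c _ ↦ hf.analyticAt c)
    (fun c _ ↦ hg.analyticAt c) ?_
  have ht : Filter.Tendsto (fun k : ℕ ↦ (((1 / ((k : ℝ) + 1) : ℝ)) : ℂ)) Filter.atTop
      (nhdsWithin 0 {0}ᶜ) := by
    refine tendsto_nhdsWithin_iff.2 ⟨?_, Filter.Eventually.of_forall fun k ↦ ?_⟩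
    · have := (Complex.continuous_ofReal.tendsto 0).comp
        (tendsto_one_div_add_atTop_nhds_zero_nat (𝕜 := ℝ))
      rwa [Complex.ofReal_zero] at this
    · simp only [Set.mem_compl_iff, Set.mem_singleton_iff, Complex.ofReal_eq_zero]
      positivity
  exact ht.frequently (Filter.Eventually.of_forall fun k ↦ h _).frequently

/-- Entire functions on `ℂⁿ` that agree on `ℝⁿ` are equal. -/
theorem eq_of_eqOn_real {F G : EuclideanSpace ℂ (Fin n) → ℂ} (hF : Differentiable ℂ F)
    (hG : Differentiable ℂ G) (h : ∀ x, F (complexPoint x 0) = G (complexPoint x 0)) : F = G := by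
  ext z
  obtain ⟨x, y, rfl⟩ := exists_complexPoint_eq z
  -- The slice `c ↦ x + c y` lies in `ℝⁿ` for real `c` and passes through `x + iy` at `c = i`.
  have hline : ∀ H : EuclideanSpace ℂ (Fin n) → ℂ, Differentiable ℂ H →
      Differentiable ℂ (fun c : ℂ ↦ H (complexPoint x 0 + c • complexPoint y 0)) := by
    intro H hH
    fun_prop
  have heq := eq_of_eq_ofReal (hline F hF) (hline G hG) fun s ↦ ?_
  · have := congrFun heq Complex.I
    simpa [complexPoint_add_smul] using this
  · simp only [complexPoint_add_smul, Complex.ofReal_im, Complex.ofReal_re, zero_smul, add_zero]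
    exact h _

end ComplexPoint

/-! ### Gaussian bounds from the maximum principle. -/

section RealDecay

variable {n : ℕ} {F : EuclideanSpace ℂ (Fin n) → ℂ} {N a b : ℝ}

/-- An entire function of Gaussian growth in the imaginary directions that has Gaussian decay on
`ℝⁿ` has Gaussian decay near `ℝⁿ`. -/
theorem gaussian_bound_of_real_decay (hF : Differentiable ℂ F) (hN : 0 < N) (ha : 0 < a)
    (hb : 0 < b) (hgrowth : ∀ x y, ‖F (complexPoint x y)‖ ≤ N * Real.exp (b * ‖y‖ ^ 2))
    (hdecay : ∀ x, ‖F (complexPoint x 0)‖ ≤ N * Real.exp (-a * ‖x‖ ^ 2)) :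
    ∃ N' a' b' : ℝ, 0 < N' ∧ 0 < a' ∧ 0 < b' ∧ ∀ x y,
      ‖F (complexPoint x y)‖ ≤ N' * Real.exp (-a' * ‖x‖ ^ 2 + b' * ‖y‖ ^ 2) := by
  -- With `r = |x|/2`, Young's inequality spends half of `a r²` on the linear term, which leaves `a
  -- r²/2 = a|x|²/8` and costs `(b + 2a)²/(2a) |y|²`. The summand `a/2` serves the region `|x| ≤
  -- 2|y|`, where growth alone suffices.
  refine ⟨N, a / 8, b + a / 2 + (b + 2 * a) ^ 2 / (2 * a), hN, by positivity, by positivity,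
    fun x y ↦ ?_⟩
  have hc : 0 ≤ (b + 2 * a) ^ 2 / (2 * a) := by positivity
  rcases le_or_gt (‖x‖ / 2) ‖y‖ with hxy | hxy
  · refine (hgrowth x y).trans ?_
    have h1 : ‖x‖ ^ 2 ≤ 4 * ‖y‖ ^ 2 := by nlinarith [norm_nonneg x, norm_nonneg y]
    gcongr
    nlinarith [mul_le_mul_of_nonneg_left h1 ha.le, mul_nonneg hc (sq_nonneg ‖y‖)]
  · set r := ‖x‖ / 2 with hr
    have hr0 : 0 < r := (norm_nonneg y).trans_lt hxy
    set w : EuclideanSpace ℝ (Fin n) := ‖y‖⁻¹ • y with hw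
    have hw1 : ‖w‖ ≤ 1 := by
      rw [hw, norm_smul, norm_inv, norm_norm]
      exact inv_mul_le_one
    have hyw : ‖y‖ • w = y := by
      rcases eq_or_ne y 0 with rfl | hy
      · simp
      · rw [hw, smul_smul, mul_inv_cancel₀ (norm_ne_zero_iff.2 hy), one_smul]
    have hf : Differentiable ℂ fun c : ℂ ↦ F (complexPoint x 0 + c • complexPoint w 0) := by
      fun_prop
    -- On the base `t = 0` one has `|x + sw| ≥ r`, hence decay `exp (-a r²)`. The slope `(b + 2a) r`
    -- is just enough for the majorant to exceed `b t²` on the other three sides.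
    have hrect := norm_le_exp_quadratic_of_rectangle hf (N := N) (α := -a * r ^ 2)
      (β := (b + 2 * a) * r) (γ := a) hr0 hr0 ?_ (t := ‖y‖) ⟨norm_nonneg y, hxy.le⟩
    · rw [complexPoint_add_smul] at hrect
      simp only [Complex.mul_re, Complex.ofReal_re, Complex.I_re, mul_zero, Complex.ofReal_im,
        Complex.I_im, mul_one, sub_self, zero_smul, add_zero, Complex.mul_im, zero_add, hyw]
        at hrect
      refine hrect.trans ?_
      have hx : ‖x‖ = 2 * r := by rw [hr]; ring
      have key : (b + 2 * a) * r * ‖y‖ ≤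
          a * r ^ 2 / 2 + (b + 2 * a) ^ 2 / (2 * a) * ‖y‖ ^ 2 := by
        have : 0 ≤ (a * r - (b + 2 * a) * ‖y‖) ^ 2 / (2 * a) := by positivity
        have h2 : (a * r - (b + 2 * a) * ‖y‖) ^ 2 / (2 * a) = a * r ^ 2 / 2 +
          (b + 2 * a) ^ 2 / (2 * a) * ‖y‖ ^ 2 - (b + 2 * a) * r * ‖y‖ := by
          field_simp
          ring
        linarith
      gcongr
      rw [hx]
      nlinarith [mul_nonneg hb.le (sq_nonneg ‖y‖), mul_nonneg ha.le (sq_nonneg ‖y‖)]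
    · intro s hs t ht hst
      rw [complexPoint_add_smul]
      simp only [Complex.add_re, Complex.mul_re, Complex.ofReal_re, Complex.I_re, mul_zero,
        Complex.ofReal_im, Complex.I_im, mul_one, sub_self, add_zero, Complex.add_im,
        Complex.mul_im, zero_add]
      have hs2 : s ^ 2 ≤ r ^ 2 := sq_le_sq' hs.1 hs.2
      have hwt : b * ‖t • w‖ ^ 2 ≤ b * t ^ 2 := by
        rw [norm_smul, mul_pow, Real.norm_eq_abs, sq_abs]
        have := pow_le_one₀ (norm_nonneg w) hw1 (n := 2)
        nlinarith [mul_le_mul_of_nonneg_left this (mul_nonneg hb.le (sq_nonneg t))]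
      have hbt : b * t ^ 2 ≤ b * r * t := by
        nlinarith [mul_nonneg (mul_nonneg hb.le ht.1) (sub_nonneg.2 ht.2)]
      have hat : a * t ^ 2 ≤ a * r * t := by
        nlinarith [mul_nonneg (mul_nonneg ha.le ht.1) (sub_nonneg.2 ht.2)]
      rcases eq_or_ne t 0 with rfl | ht0
      · simp only [zero_smul]
        refine (hdecay _).trans ?_
        have h1 : r ≤ ‖x + s • w‖ := by
          have h2 : ‖s • w‖ ≤ r := by
            rw [norm_smul]
            calc ‖s‖ * ‖w‖ ≤ ‖s‖ * 1 := by gcongr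
              _ ≤ r := by rw [mul_one]; exact abs_le.2 hs
          have h3 := norm_sub_norm_le x (-(s • w))
          rw [norm_neg, sub_neg_eq_add] at h3
          linarith
        have h4 : r ^ 2 ≤ ‖x + s • w‖ ^ 2 := by gcongr
        gcongr
        nlinarith [mul_le_mul_of_nonneg_left h4 ha.le, mul_nonneg ha.le (sq_nonneg s)]
      · refine (hgrowth _ _).trans ?_
        gcongr
        refine hwt.trans ?_
        have hart : 0 ≤ a * r * t := by have := ht.1; positivity
        rcases hst with rfl | rfl | rfl | rfl
        · nlinarith
        · nlinarith
        · exact absurd rfl ht0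
        · nlinarith [mul_nonneg ha.le (sq_nonneg s)]

/-- If `F` and `exp (iκ z²) F` both have at most Gaussian growth in the imaginary directions, then
`F` has Gaussian decay on `ℝⁿ`. -/
theorem real_decay_of_chirp_bound {κ : ℝ} (hF : Differentiable ℂ F) (hb : 0 < b) (hκ : κ ≠ 0)
    (hN : 0 < N)
    (h₁ : ∀ x y, ‖F (complexPoint x y)‖ ≤ N * Real.exp (b * ‖y‖ ^ 2))
    (h₂ : ∀ x y, ‖Complex.exp (Complex.I * κ * sumSq (complexPoint x y)) * F (complexPoint x y)‖ ≤
      N * Real.exp (b * ‖y‖ ^ 2)) :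
    ∃ a : ℝ, 0 < a ∧ ∀ x, ‖F (complexPoint x 0)‖ ≤ N * Real.exp (-a * ‖x‖ ^ 2) := by
  have h₃ : ∀ x y : EuclideanSpace ℝ (Fin n), ‖F (complexPoint x y)‖ ≤
      N * Real.exp (b * ‖y‖ ^ 2 + 2 * κ * inner ℝ x y) := by
    intro x y
    have := h₂ x y
    rw [norm_mul, norm_exp_sumSq] at this
    simp only [Complex.mul_re, Complex.I_re, Complex.ofReal_re, zero_mul, Complex.I_im,
      Complex.ofReal_im, mul_zero, sub_self, Complex.mul_im, one_mul, zero_add, zero_sub] at this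
    rw [add_comm, Real.exp_add]
    calc ‖F (complexPoint x y)‖ = Real.exp (2 * κ * inner ℝ x y) *
          (Real.exp (-(2 * κ * inner ℝ x y)) * ‖F (complexPoint x y)‖) := by
          rw [← mul_assoc, ← Real.exp_add]
          simp
      _ ≤ Real.exp (2 * κ * inner ℝ x y) * (N * Real.exp (b * ‖y‖ ^ 2)) := by gcongr
      _ = _ := by ring
  set k := |κ| with hk
  have hk0 : 0 < k := abs_pos.2 hκ
  -- The bound `1/2` keeps `1 + s ≥ 1/2`; the other gives `(b + 2) t² ≤ k|t|/2` for `|t| ≤ r`.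
  set r := min (1 / 2) (k / (2 * (2 + b))) with hr
  have hr0 : 0 < r := by positivity
  have hr1 : r ≤ 1 / 2 := min_le_left _ _
  have hr2 : r * (2 * (2 + b)) ≤ k := (le_div_iff₀ (by positivity)).1 (min_le_right _ _)
  refine ⟨r ^ 2, by positivity, fun x ↦ ?_⟩
  obtain ⟨σ, hσ⟩ : ∃ σ : ℝ, σ ^ 2 = 1 ∧ κ = -(k * σ) := by
    rcases abs_cases κ with ⟨h, -⟩ | ⟨h, -⟩
    · exact ⟨-1, by norm_num, by rw [hk, h]; ring⟩
    · exact ⟨1, by norm_num, by rw [hk, h]; ring⟩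
  have hσ' : σ = 1 ∨ σ = -1 := mul_self_eq_one_iff.1 (by rw [← pow_two]; exact hσ.1)
  set X := ‖x‖ ^ 2 with hX
  have hX0 : 0 ≤ X := by positivity
  have hf : Differentiable ℂ fun c : ℂ ↦ F (complexPoint x 0 + c • complexPoint x 0) := by
    fun_prop
  -- In units of `|x|²`, the slice `c ↦ x + c x` has exponents `b t²` and `b t² - 2kσ(1 + s)t`. The
  -- smaller one is at most `b t² - k|t|` where `σt ≥ 0` and `b t²` elsewhere. Removing the harmonic
  -- term `-kσt/2` leaves at most `b t² - k|t|/2` on both sides, which is below `s² - t² - r²` on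
  -- the boundary of the square; at the centre this is `-r²`.
  have hrect := norm_le_exp_quadratic_of_rectangle hf (N := N) (α := -r ^ 2 * X)
    (β := -(k * σ / 2) * X) (γ := X) hr0 (neg_lt_self hr0) ?_ (t := 0) ⟨by linarith, hr0.le⟩
  · simpa using hrect
  intro s hs t ht hst
  rw [complexPoint_add_smul]
  simp only [Complex.add_re, Complex.mul_re, Complex.ofReal_re, Complex.I_re, mul_zero,
    Complex.ofReal_im, Complex.I_im, mul_one, sub_self, add_zero, Complex.add_im,
    Complex.mul_im, zero_add]
  have hb1 := h₁ (x + s • x) (t • x)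
  have hb2 := h₃ (x + s • x) (t • x)
  have hin : inner ℝ (x + s • x) (t • x) = (1 + s) * t * X := by
    rw [inner_add_left, real_inner_smul_left, real_inner_smul_right, real_inner_self_eq_norm_sq]
    ring
  have hno : ‖t • x‖ ^ 2 = t ^ 2 * X := by
    rw [norm_smul, mul_pow, Real.norm_eq_abs, sq_abs]
  rw [hno] at hb1
  rw [hno, hin] at hb2
  have ht2 : t ^ 2 ≤ r ^ 2 := sq_le_sq' ht.1 ht.2
  have hs2 : s ^ 2 ≤ r ^ 2 := sq_le_sq' hs.1 hs.2
  have hat : |t| ≤ r := abs_le.2 ht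
  have hst' : (b + 1) * t ^ 2 - k * |t| / 2 + r ^ 2 ≤ s ^ 2 := by
    have e : t ^ 2 = |t| ^ 2 := (sq_abs t).symm
    have ht0 := abs_nonneg t
    have h5 : (s = -r ∨ s = r) ∨ |t| = r := by
      rcases hst with h | h | h | h
      · exact Or.inl (Or.inl h)
      · exact Or.inl (Or.inr h)
      · exact Or.inr (by rw [h, abs_neg, abs_of_pos hr0])
      · exact Or.inr (by rw [h, abs_of_pos hr0])
    have h6 : (b + 2) * |t| ^ 2 ≤ k * |t| / 2 := by
      have : (b + 2) * |t| ≤ k / 2 := by nlinarith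
      nlinarith
    rcases h5 with h5 | h5
    · have : s ^ 2 = r ^ 2 := by rcases h5 with rfl | rfl <;> ring
      rw [this, e]
      nlinarith [sq_nonneg |t|]
    · rw [e, h5]
      rw [h5] at h6
      nlinarith [sq_nonneg s]
  have hlow : b * t ^ 2 * X - k * |t| / 2 * X ≤ -r ^ 2 * X + X * (s ^ 2 - t ^ 2) := by
    nlinarith [mul_le_mul_of_nonneg_right hst' hX0]
  rcases le_or_gt 0 (σ * t) with h | h
  · have habs : |t| = σ * t := by
      rw [← abs_of_nonneg h, abs_mul]
      rcases hσ' with rfl | rfl <;> simp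
    refine hb2.trans (mul_le_mul_of_nonneg_left (Real.exp_le_exp.2 ?_) hN.le)
    rw [hσ.2]
    have h7 : k * |t| * X ≤ 2 * k * |t| * (1 + s) * X := by
      have : 0 ≤ k * |t| * X := by positivity
      nlinarith [hs.1]
    rw [habs] at h7 hlow
    nlinarith
  · have habs : |t| = -(σ * t) := by
      rw [← abs_of_neg h, abs_mul]
      rcases hσ' with rfl | rfl <;> simp
    refine hb1.trans (mul_le_mul_of_nonneg_left (Real.exp_le_exp.2 ?_) hN.le)
    rw [habs] at hlow
    nlinarith

end RealDecay

end GaussianDecay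

namespace GaussianDecay

variable {n : ℕ}

/-! ### Integrability under Gaussian weights. -/

section Integrability

theorem integrable_exp_neg_mul_norm_sq {a : ℝ} (ha : 0 < a) :
    Integrable fun x : EuclideanSpace ℝ (Fin n) ↦ Real.exp (-a * ‖x‖ ^ 2) := by
  have h := (GaussianFourier.integrable_cexp_neg_mul_sq_norm_add (V := EuclideanSpace ℝ (Fin n))
    (b := (a : ℂ)) (by simpa using ha) 0 0).norm
  refine h.congr (Filter.Eventually.of_forall fun x ↦ ?_)
  simp only [Complex.norm_exp]
  congr 1
  simp [← Complex.ofReal_pow]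

theorem memLp_two_gaussianWeight_iff {a : ℝ} {f : EuclideanSpace ℝ (Fin n) → ℂ} :
    MemLp f 2 (volume.withDensity fun x ↦ ENNReal.ofReal (Real.exp (a * ‖x‖ ^ 2))) ↔
      AEStronglyMeasurable f volume ∧
        Integrable fun x ↦ Real.exp (a * ‖x‖ ^ 2) * ‖f x‖ ^ 2 := by
  have hmeas : Measurable fun x : EuclideanSpace ℝ (Fin n) ↦
      ENNReal.ofReal (Real.exp (a * ‖x‖ ^ 2)) := by fun_prop
  have hint : Integrable (fun x ↦ ‖f x‖ ^ 2)
      (volume.withDensity fun x ↦ ENNReal.ofReal (Real.exp (a * ‖x‖ ^ 2))) ↔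
        Integrable fun x ↦ Real.exp (a * ‖x‖ ^ 2) * ‖f x‖ ^ 2 := by
    rw [integrable_withDensity_iff_integrable_smul' hmeas (by simp)]
    simp [ENNReal.toReal_ofReal, Real.exp_nonneg]
  have h1 : (volume : Measure (EuclideanSpace ℝ (Fin n))) ≪
      volume.withDensity fun x ↦ ENNReal.ofReal (Real.exp (a * ‖x‖ ^ 2)) :=
    withDensity_absolutelyContinuous' hmeas.aemeasurable
      (Filter.Eventually.of_forall fun x ↦ by simp [Real.exp_pos])
  constructor
  · intro h
    exact ⟨h.aestronglyMeasurable.mono_ac h1,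
      hint.1 ((memLp_two_iff_integrable_sq_norm h.aestronglyMeasurable).1 h)⟩
  · rintro ⟨hm, hi⟩
    exact (memLp_two_iff_integrable_sq_norm
      (hm.mono_ac (withDensity_absolutelyContinuous _ _))).2 (hint.2 hi)

/-- Split the weight as `exp (a|x|²/2) exp (-a|x|²/4)` and bound the product by the sum of squares.
-/
theorem integrable_exp_mul_norm_of_sq {a : ℝ} (ha : 0 < a) {f : EuclideanSpace ℝ (Fin n) → ℂ}
    (hm : AEStronglyMeasurable f volume)
    (hi : Integrable fun x ↦ Real.exp (a * ‖x‖ ^ 2) * ‖f x‖ ^ 2) :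
    Integrable fun x ↦ Real.exp (a / 4 * ‖x‖ ^ 2) * ‖f x‖ := by
  refine (hi.add (integrable_exp_neg_mul_norm_sq (n := n) (half_pos ha))).mono'
    ((by fun_prop : Continuous fun x : EuclideanSpace ℝ (Fin n) ↦
      Real.exp (a / 4 * ‖x‖ ^ 2)).aestronglyMeasurable.mul hm.norm)
    (Filter.Eventually.of_forall fun x ↦ ?_)
  rw [Real.norm_of_nonneg (by positivity)]
  have e1 : Real.exp (a * ‖x‖ ^ 2) = Real.exp (a / 2 * ‖x‖ ^ 2) ^ 2 := by
    rw [← Real.exp_nat_mul]; congr 1; push_cast; ring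
  have e2 : Real.exp (-(a / 2) * ‖x‖ ^ 2) = Real.exp (-(a / 4) * ‖x‖ ^ 2) ^ 2 := by
    rw [← Real.exp_nat_mul]; congr 1; push_cast; ring
  have e3 : Real.exp (a / 4 * ‖x‖ ^ 2) =
      Real.exp (a / 2 * ‖x‖ ^ 2) * Real.exp (-(a / 4) * ‖x‖ ^ 2) := by
    rw [← Real.exp_add]; congr 1; ring
  simp only [Pi.add_apply]
  rw [e1, e2, e3]
  have hp : 0 ≤ Real.exp (a / 2 * ‖x‖ ^ 2) * ‖f x‖ := by positivity
  have hq : 0 ≤ Real.exp (-(a / 4) * ‖x‖ ^ 2) := by positivity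
  nlinarith [sq_nonneg (Real.exp (a / 2 * ‖x‖ ^ 2) * ‖f x‖ - Real.exp (-(a / 4) * ‖x‖ ^ 2)),
    mul_nonneg hp hq]

/-- Completing the square, `R|x| ≤ a|x|² + R²/(4a)`. This is what turns decay of `f` into growth of
its transform. -/
theorem integrable_exp_linear_mul {a : ℝ} (ha : 0 < a) {f : EuclideanSpace ℝ (Fin n) → ℂ}
    (hm : AEStronglyMeasurable f volume)
    (hi : Integrable fun x ↦ Real.exp (a * ‖x‖ ^ 2) * ‖f x‖) (R : ℝ) :
    Integrable (fun x ↦ Real.exp (R * ‖x‖) * ‖f x‖) ∧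
      ∫ x, Real.exp (R * ‖x‖) * ‖f x‖ ≤
        (∫ x, Real.exp (a * ‖x‖ ^ 2) * ‖f x‖) * Real.exp ((4 * a)⁻¹ * R ^ 2) := by
  have hle : ∀ x : EuclideanSpace ℝ (Fin n), Real.exp (R * ‖x‖) * ‖f x‖ ≤
      Real.exp (a * ‖x‖ ^ 2) * ‖f x‖ * Real.exp ((4 * a)⁻¹ * R ^ 2) := by
    intro x
    rw [mul_right_comm, ← Real.exp_add]
    gcongr
    have h1 : a * ‖x‖ ^ 2 + (4 * a)⁻¹ * R ^ 2 - R * ‖x‖ = (2 * a * ‖x‖ - R) ^ 2 / (4 * a) := by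
      field_simp
      ring
    have h2 : 0 ≤ (2 * a * ‖x‖ - R) ^ 2 / (4 * a) := by positivity
    linarith
  have hint : Integrable (fun x ↦ Real.exp (R * ‖x‖) * ‖f x‖) := by
    refine (hi.mul_const (Real.exp ((4 * a)⁻¹ * R ^ 2))).mono'
      ((by fun_prop : Continuous fun x : EuclideanSpace ℝ (Fin n) ↦
        Real.exp (R * ‖x‖)).aestronglyMeasurable.mul hm.norm)
      (Filter.Eventually.of_forall fun x ↦ ?_)
    rw [Real.norm_of_nonneg (by positivity)]
    exact hle x
  refine ⟨hint, ?_⟩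
  rw [← integral_mul_const]
  exact integral_mono hint (hi.mul_const _) hle

theorem integrable_of_exp_mul_norm {a : ℝ} (ha : 0 < a) {f : EuclideanSpace ℝ (Fin n) → ℂ}
    (hm : AEStronglyMeasurable f volume)
    (hi : Integrable fun x ↦ Real.exp (a * ‖x‖ ^ 2) * ‖f x‖) : Integrable f := by
  have h := (integrable_exp_linear_mul ha hm hi 0).1
  simp only [zero_mul, Real.exp_zero, one_mul] at h
  exact (integrable_norm_iff hm).1 h

end Integrability

/-! ### The Fourier–Laplace transform of a function with Gaussian decay. -/

section FourierLaplace

/-- The constant `(2π)^(-n/2)`. -/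
noncomputable def fourierConst (n : ℕ) : ℝ := (2 * Real.pi) ^ (-(n : ℝ) / 2)

theorem fourierConst_pos (n : ℕ) : 0 < fourierConst n := by
  unfold fourierConst
  positivity

/-- The Fourier–Laplace transform `ζ ↦ (2π)^(-n/2) ∫ exp (-i x·ζ) f(x) dx` on `ℂⁿ`. -/
noncomputable def fourierLaplace (f : EuclideanSpace ℝ (Fin n) → ℂ)
    (z : EuclideanSpace ℂ (Fin n)) : ℂ :=
  (fourierConst n : ℂ) * ∫ x, Complex.exp (-Complex.I * dotCLM x z) * f x

theorem norm_exp_dotCLM (x ξ η : EuclideanSpace ℝ (Fin n)) :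
    ‖Complex.exp (-Complex.I * dotCLM x (complexPoint ξ η))‖ = Real.exp (inner ℝ x η) := by
  rw [Complex.norm_exp, dotCLM_complexPoint]
  congr 1
  simp

theorem norm_exp_dotCLM_le (x : EuclideanSpace ℝ (Fin n)) (z : EuclideanSpace ℂ (Fin n)) :
    ‖Complex.exp (-Complex.I * dotCLM x z)‖ ≤ Real.exp (‖z‖ * ‖x‖) := by
  refine (Complex.norm_exp_le_exp_norm _).trans (Real.exp_le_exp.2 ?_)
  rw [norm_mul, norm_neg, Complex.norm_I, one_mul, mul_comm, ← norm_dotCLM x]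
  exact (dotCLM x).le_opNorm z

variable {a : ℝ} {f : EuclideanSpace ℝ (Fin n) → ℂ}

theorem continuous_exp_dotCLM (z : EuclideanSpace ℂ (Fin n)) :
    Continuous fun x : EuclideanSpace ℝ (Fin n) ↦ Complex.exp (-Complex.I * dotCLM x z) := by
  have : Continuous fun x : EuclideanSpace ℝ (Fin n) ↦ dotCLM x z :=
    continuous_dotCLM.clm_apply continuous_const
  fun_prop

theorem integrable_exp_dotCLM_mul (ha : 0 < a) (hm : AEStronglyMeasurable f volume)
    (hi : Integrable fun x ↦ Real.exp (a * ‖x‖ ^ 2) * ‖f x‖) (z : EuclideanSpace ℂ (Fin n)) :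
    Integrable fun x ↦ Complex.exp (-Complex.I * dotCLM x z) * f x := by
  refine (integrable_exp_linear_mul ha hm hi ‖z‖).1.mono'
    ((continuous_exp_dotCLM z).aestronglyMeasurable.mul hm)
    (Filter.Eventually.of_forall fun x ↦ ?_)
  rw [norm_mul]
  gcongr
  exact norm_exp_dotCLM_le x z

theorem fourierLaplace_growth (ha : 0 < a) (hm : AEStronglyMeasurable f volume)
    (hi : Integrable fun x ↦ Real.exp (a * ‖x‖ ^ 2) * ‖f x‖) :
    ∃ N b : ℝ, 0 < N ∧ 0 < b ∧ ∀ ξ η,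
      ‖fourierLaplace f (complexPoint ξ η)‖ ≤ N * Real.exp (b * ‖η‖ ^ 2) := by
  set J := ∫ x, Real.exp (a * ‖x‖ ^ 2) * ‖f x‖ with hJ
  have hJ0 : 0 ≤ J := integral_nonneg fun x ↦ by positivity
  have hc := fourierConst_pos n
  -- The summand `1` keeps the constant positive when `f` vanishes.
  refine ⟨fourierConst n * J + 1, (4 * a)⁻¹, by positivity, by positivity, fun ξ η ↦ ?_⟩
  obtain ⟨h1, h2⟩ := integrable_exp_linear_mul ha hm hi ‖η‖
  rw [fourierLaplace, norm_mul, Complex.norm_real, Real.norm_of_nonneg hc.le]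
  calc fourierConst n * ‖∫ x, Complex.exp (-Complex.I * dotCLM x (complexPoint ξ η)) * f x‖
      ≤ fourierConst n * ∫ x, Real.exp (‖η‖ * ‖x‖) * ‖f x‖ := by
        gcongr
        refine norm_integral_le_of_norm_le h1 (Filter.Eventually.of_forall fun x ↦ ?_)
        rw [norm_mul, norm_exp_dotCLM]
        gcongr
        rw [mul_comm]
        exact real_inner_le_norm x η
    _ ≤ fourierConst n * (J * Real.exp ((4 * a)⁻¹ * ‖η‖ ^ 2)) := by gcongr
    _ ≤ (fourierConst n * J + 1) * Real.exp ((4 * a)⁻¹ * ‖η‖ ^ 2) := by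
        nlinarith [Real.exp_pos ((4 * a)⁻¹ * ‖η‖ ^ 2)]

theorem differentiable_fourierLaplace (ha : 0 < a) (hm : AEStronglyMeasurable f volume)
    (hi : Integrable fun x ↦ Real.exp (a * ‖x‖ ^ 2) * ‖f x‖) :
    Differentiable ℂ (fourierLaplace f) := by
  intro z₀
  refine DifferentiableAt.const_mul ?_ _
  set F' : EuclideanSpace ℂ (Fin n) → EuclideanSpace ℝ (Fin n) → EuclideanSpace ℂ (Fin n) →L[ℂ] ℂ :=
    fun z x ↦ (Complex.exp (-Complex.I * dotCLM x z) * f x) • (-Complex.I • dotCLM x) with hF'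
  -- In `‖z₀‖ + 2`, one unit is the radius of the ball and the other absorbs the factor `|x| ≤ exp
  -- |x|` from the derivative.
  refine (hasFDerivAt_integral_of_dominated_of_fderiv_le (F' := F')
    (bound := fun x ↦ Real.exp ((‖z₀‖ + 2) * ‖x‖) * ‖f x‖) (Metric.ball_mem_nhds z₀ one_pos)
    (Filter.Eventually.of_forall fun z ↦ (continuous_exp_dotCLM z).aestronglyMeasurable.mul hm)
    (integrable_exp_dotCLM_mul ha hm hi z₀) ?_ ?_ (integrable_exp_linear_mul ha hm hi _).1
    ?_).differentiableAt
  · exact ((continuous_exp_dotCLM z₀).aestronglyMeasurable.mul hm).smul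
      (continuous_dotCLM.const_smul (-Complex.I)).aestronglyMeasurable
  · refine Filter.Eventually.of_forall fun x z hz ↦ ?_
    have hz' : ‖z‖ ≤ ‖z₀‖ + 1 := by
      have h1 := norm_sub_norm_le z z₀
      rw [mem_ball_iff_norm] at hz
      linarith
    rw [hF']
    simp only
    rw [norm_smul, norm_smul, norm_neg, Complex.norm_I, one_mul, norm_dotCLM, norm_mul,
      mul_right_comm]
    gcongr
    calc ‖Complex.exp (-Complex.I * dotCLM x z)‖ * ‖x‖
        ≤ Real.exp ((‖z₀‖ + 1) * ‖x‖) * Real.exp ‖x‖ := by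
          gcongr
          · exact (norm_exp_dotCLM_le x z).trans (by gcongr)
          · linarith [Real.add_one_le_exp ‖x‖]
      _ = Real.exp ((‖z₀‖ + 2) * ‖x‖) := by
          rw [← Real.exp_add]
          congr 1
          ring
  · refine Filter.Eventually.of_forall fun x z _ ↦ ?_
    have h1 : HasFDerivAt (fun z ↦ -Complex.I * dotCLM x z) (-Complex.I • dotCLM x) z :=
      (dotCLM x).hasFDerivAt.const_mul _
    convert! h1.cexp.mul_const (f x) using 1
    rw [hF', smul_smul, mul_comm (f x)]

/-- Needed to pass from `L²` decay of the transform to pointwise decay. -/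
theorem fourierLaplace_lipschitz (ha : 0 < a) (hm : AEStronglyMeasurable f volume)
    (hi : Integrable fun x ↦ Real.exp (a * ‖x‖ ^ 2) * ‖f x‖) :
    ∃ L : ℝ, ∀ ξ η, ‖fourierLaplace f (complexPoint ξ 0) - fourierLaplace f (complexPoint η 0)‖ ≤
      L * ‖ξ - η‖ := by
  have hc := fourierConst_pos n
  refine ⟨fourierConst n * ∫ x, Real.exp (1 * ‖x‖) * ‖f x‖, fun ξ η ↦ ?_⟩
  rw [fourierLaplace, fourierLaplace, ← mul_sub, ← integral_sub
    (integrable_exp_dotCLM_mul ha hm hi _) (integrable_exp_dotCLM_mul ha hm hi _), norm_mul,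
    Complex.norm_real, Real.norm_of_nonneg hc.le, mul_assoc, ← integral_mul_const]
  gcongr
  refine norm_integral_le_of_norm_le ((integrable_exp_linear_mul ha hm hi 1).1.mul_const _)
    (Filter.Eventually.of_forall fun x ↦ ?_)
  rw [← sub_mul, norm_mul, mul_right_comm]
  gcongr
  have h1 : Complex.exp (-Complex.I * dotCLM x (complexPoint ξ 0)) -
      Complex.exp (-Complex.I * dotCLM x (complexPoint η 0)) =
      Complex.exp (-Complex.I * dotCLM x (complexPoint η 0)) *
        (Complex.exp (Complex.I * ((inner ℝ x (η - ξ) : ℝ) : ℂ)) - 1) := by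
    rw [mul_sub, ← Complex.exp_add, mul_one, dotCLM_complexPoint, dotCLM_complexPoint,
      inner_sub_right]
    congr 2
    push_cast
    simp
    ring
  rw [h1, norm_mul, norm_exp_dotCLM, inner_zero_right, Real.exp_zero, one_mul]
  calc _ ≤ ‖(inner ℝ x (η - ξ) : ℝ)‖ := Real.norm_exp_I_mul_ofReal_sub_one_le
    _ ≤ ‖x‖ * ‖η - ξ‖ := norm_inner_le_norm _ _
    _ ≤ Real.exp (1 * ‖x‖) * ‖ξ - η‖ := by
      rw [norm_sub_rev, one_mul]
      gcongr
      linarith [Real.add_one_le_exp ‖x‖]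

theorem IsFunction.fourier {u : TemperedDistribution (EuclideanSpace ℝ (Fin n)) ℂ}
    (hu : IsFunction u f) (ha : 0 < a) (hm : AEStronglyMeasurable f volume)
    (hi : Integrable fun x ↦ Real.exp (a * ‖x‖ ^ 2) * ‖f x‖) :
    IsFunction (GaussianDecay.fourier u) fun ξ ↦ fourierLaplace f (complexPoint ξ 0) := by
  intro φ
  have hfi : Integrable f := integrable_of_exp_mul_norm ha hm hi
  have hexp : ∀ x ξ : EuclideanSpace ℝ (Fin n),
      Complex.exp (-Complex.I * dotCLM x (complexPoint ξ 0)) =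
        Complex.exp (-Complex.I * ((inner ℝ ξ x : ℝ) : ℂ)) := by
    intro x ξ
    rw [dotCLM_complexPoint, inner_zero_right, real_inner_comm]
    simp
  have hprod : Integrable (Function.uncurry fun ξ x : EuclideanSpace ℝ (Fin n) ↦
      Complex.exp (-Complex.I * ((inner ℝ ξ x : ℝ) : ℂ)) * (φ ξ * f x)) (volume.prod volume) := by
    have h1 := (φ.integrable (μ := volume)).mul_prod hfi
    refine h1.bdd_mul (c := 1) ?_ ?_
    · refine Continuous.aestronglyMeasurable ?_
      fun_prop
    · refine Filter.Eventually.of_forall fun p ↦ ?_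
      rw [Complex.norm_exp]
      simp
  have hL : ∀ ξ, φ ξ * fourierLaplace f (complexPoint ξ 0) = (fourierConst n : ℂ) *
      ∫ x, Complex.exp (-Complex.I * ((inner ℝ ξ x : ℝ) : ℂ)) * (φ ξ * f x) := by
    intro ξ
    rw [fourierLaplace, mul_left_comm, ← integral_const_mul]
    congr 2
    ext x
    rw [hexp]
    ring
  simp only [hL]
  refine ⟨hprod.integral_prod_left.const_mul _, ?_⟩
  rw [fourier_apply, (hu _).2, integral_const_mul, integral_integral_swap hprod,
    ← integral_const_mul]
  congr 1
  ext x
  rw [schwartzFourier_apply, mul_assoc, ← integral_mul_const, fourierConst]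
  congr 2
  ext ξ
  ring

end FourierLaplace

/-! ### Shifting the domain of integration. -/

section Contour

/-- An integral depending holomorphically on a parameter, with an integrable bound on each disc, is
holomorphic in the parameter. -/
theorem differentiable_integral_of_dominated {k : ℂ → EuclideanSpace ℝ (Fin n) → ℂ}
    (hcont : Continuous fun p : EuclideanSpace ℝ (Fin n) × ℂ ↦ k p.2 p.1)
    (hdiff : ∀ x, Differentiable ℂ fun c ↦ k c x)
    (hbound : ∀ R : ℝ, ∃ g : EuclideanSpace ℝ (Fin n) → ℝ, Integrable g ∧
      ∀ c x, ‖c‖ ≤ R → ‖k c x‖ ≤ g x) :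
    Differentiable ℂ fun c ↦ ∫ x, k c x := by
  intro c₀
  -- Cauchy's estimate on unit circles bounds the derivative by `g`; the circles centred in the unit
  -- ball about `c₀` stay within radius `‖c₀‖ + 2`.
  obtain ⟨g, hg, hgk⟩ := hbound (‖c₀‖ + 2)
  have hmeas : ∀ c, AEStronglyMeasurable (k c) volume := fun c ↦
    (hcont.comp (continuous_id.prodMk continuous_const)).aestronglyMeasurable
  refine (hasDerivAt_integral_of_dominated_loc_of_deriv_le (F' := fun c x ↦ deriv (fun c ↦ k c x) c)
    (bound := g) (Metric.ball_mem_nhds c₀ one_pos) (Filter.Eventually.of_forall hmeas)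
    (hg.mono' (hmeas c₀) (Filter.Eventually.of_forall fun x ↦ hgk c₀ x (by linarith))) ?_ ?_ hg
    ?_).2.differentiableAt
  · have h := measurable_deriv_with_param (f := fun x c ↦ k c x) hcont
    exact (h.comp (measurable_id.prodMk measurable_const)).aestronglyMeasurable
  · refine Filter.Eventually.of_forall fun x c hc ↦ ?_
    have h := Complex.norm_deriv_le_of_forall_mem_sphere_norm_le (c := c) one_pos
      (hdiff x).diffContOnCl (C := g x) fun w hw ↦ hgk w x ?_
    · simpa using h
    · rw [mem_ball_iff_norm] at hc
      rw [mem_sphere_iff_norm] at hw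
      have h1 := norm_sub_norm_le w c
      have h2 := norm_sub_norm_le c c₀
      linarith
  · exact Filter.Eventually.of_forall fun x c _ ↦ (hdiff x c).hasDerivAt

variable {F : EuclideanSpace ℂ (Fin n) → ℂ} {N a b : ℝ}

/-- Shifting the domain of integration from `ℝⁿ` to `ℝⁿ + iy`. -/
theorem integral_shift_eq (hF : Differentiable ℂ F) (hN : 0 < N) (ha : 0 < a) (hb : 0 < b)
    (hbd : ∀ x y, ‖F (complexPoint x y)‖ ≤ N * Real.exp (-a * ‖x‖ ^ 2 + b * ‖y‖ ^ 2))
    (ξ : EuclideanSpace ℝ (Fin n)) (c : ℂ) :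
    ∫ x, Complex.exp (-Complex.I * dotCLM ξ (complexPoint x 0 + c • complexPoint ξ 0)) *
      F (complexPoint x 0 + c • complexPoint ξ 0) =
    ∫ x, Complex.exp (-Complex.I * dotCLM ξ (complexPoint x 0)) * F (complexPoint x 0) := by
  set H : EuclideanSpace ℂ (Fin n) → ℂ := fun z ↦ Complex.exp (-Complex.I * dotCLM ξ z) * F z
    with hH
  have hHd : Differentiable ℂ H := by
    have : Differentiable ℂ fun z ↦ dotCLM ξ z := (dotCLM ξ).differentiable
    fun_prop
  have hcp : Continuous fun x : EuclideanSpace ℝ (Fin n) ↦ complexPoint x 0 :=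
    continuous_complexPoint.comp (continuous_id.prodMk continuous_const)
  have hdiff : Differentiable ℂ fun c : ℂ ↦ ∫ x, H (complexPoint x 0 + c • complexPoint ξ 0) := by
    refine differentiable_integral_of_dominated
      (k := fun c x ↦ H (complexPoint x 0 + c • complexPoint ξ 0)) ?_ ?_ ?_
    · refine hHd.continuous.comp ?_
      exact (hcp.comp continuous_fst).add (continuous_snd.smul continuous_const)
    · intro x
      fun_prop
    · intro R
      refine ⟨fun x ↦ Real.exp (R * ‖ξ‖ ^ 2) * (N * (Real.exp ((a + b) * (R * ‖ξ‖) ^ 2) *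
        Real.exp (-(a / 2) * ‖x‖ ^ 2))), ((integrable_exp_neg_mul_norm_sq
          (half_pos ha)).const_mul _ |>.const_mul _ |>.const_mul _), fun c x hc ↦ ?_⟩
      have hre : |c.re| ≤ R := (Complex.abs_re_le_norm c).trans hc
      have him : |c.im| ≤ R := (Complex.abs_im_le_norm c).trans hc
      have hR : 0 ≤ R := (abs_nonneg _).trans hre
      rw [hH]
      simp only
      rw [complexPoint_add_smul, zero_add, norm_mul, norm_exp_dotCLM, real_inner_smul_right,
        real_inner_self_eq_norm_sq]
      refine mul_le_mul ?_ ((hbd _ _).trans ?_) (norm_nonneg _) (Real.exp_nonneg _)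
      · gcongr
        exact (le_abs_self _).trans him
      · rw [← Real.exp_add]
        refine mul_le_mul_of_nonneg_left (Real.exp_le_exp.2 ?_) hN.le
        have h1 : ‖c.im • ξ‖ ≤ R * ‖ξ‖ := by
          rw [norm_smul]
          gcongr
          exact him
        have h2 : ‖c.re • ξ‖ ≤ R * ‖ξ‖ := by
          rw [norm_smul]
          gcongr
          exact hre
        have h3 : ‖x‖ ≤ ‖x + c.re • ξ‖ + ‖c.re • ξ‖ := by
          have := norm_sub_le (x + c.re • ξ) (c.re • ξ)
          rwa [add_sub_cancel_right] at this
        have h4 : ‖x‖ ^ 2 ≤ 2 * ‖x + c.re • ξ‖ ^ 2 + 2 * (R * ‖ξ‖) ^ 2 := by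
          have h5 : ‖x‖ ≤ ‖x + c.re • ξ‖ + R * ‖ξ‖ := by linarith
          have h6 : ‖x‖ ^ 2 ≤ (‖x + c.re • ξ‖ + R * ‖ξ‖) ^ 2 := by gcongr
          nlinarith [sq_nonneg (‖x + c.re • ξ‖ - R * ‖ξ‖)]
        have h7 : ‖c.im • ξ‖ ^ 2 ≤ (R * ‖ξ‖) ^ 2 := by gcongr
        nlinarith [mul_le_mul_of_nonneg_left h4 ha.le, mul_le_mul_of_nonneg_left h7 hb.le]
  -- No contour is drawn: the integral is entire in `c` and, by translation invariance, constant for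
  -- real `c`, hence constant.
  have hreal : ∀ s : ℝ, ∫ x, H (complexPoint x 0 + (s : ℂ) • complexPoint ξ 0) =
      ∫ x, H (complexPoint x 0) := by
    intro s
    simp only [complexPoint_add_smul, Complex.ofReal_re, Complex.ofReal_im, zero_smul, add_zero]
    exact integral_add_right_eq_self (fun x ↦ H (complexPoint x 0)) (s • ξ)
  have hconst : (fun c : ℂ ↦ ∫ x, H (complexPoint x 0 + c • complexPoint ξ 0)) =
      fun _ ↦ ∫ x, H (complexPoint x 0) :=
    eq_of_eq_ofReal hdiff (differentiable_const _) hreal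
  exact congrFun hconst c

/-- The Fourier transform of a function with a Gaussian extension has Gaussian decay. -/
theorem fourierLaplace_decay (hF : Differentiable ℂ F) (hN : 0 < N) (ha : 0 < a) (hb : 0 < b)
    (hbd : ∀ x y, ‖F (complexPoint x y)‖ ≤ N * Real.exp (-a * ‖x‖ ^ 2 + b * ‖y‖ ^ 2)) :
    ∃ N' a' : ℝ, 0 < N' ∧ 0 < a' ∧ ∀ ξ,
      ‖fourierLaplace (fun x ↦ F (complexPoint x 0)) (complexPoint ξ 0)‖ ≤
        N' * Real.exp (-a' * ‖ξ‖ ^ 2) := by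
  have hc := fourierConst_pos n
  set J := ∫ x : EuclideanSpace ℝ (Fin n), Real.exp (-a * ‖x‖ ^ 2) with hJ
  have hJ0 : 0 ≤ J := integral_nonneg fun x ↦ by positivity
  refine ⟨fourierConst n * (N * J) + 1, (4 * b)⁻¹, by positivity, by positivity, fun ξ ↦ ?_⟩
  -- The shift by `-iεξ` contributes `-ε|ξ|² + bε²|ξ|²`, which is least, namely `-|ξ|²/(4b)`, at
  -- this `ε`.
  set ε := (2 * b)⁻¹ with hε
  have hshift := integral_shift_eq hF hN ha hb hbd ξ (-(ε : ℂ) * Complex.I)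
  have hsymm : ∀ x, dotCLM x (complexPoint ξ 0) = dotCLM ξ (complexPoint x 0) := by
    intro x
    rw [dotCLM_complexPoint, dotCLM_complexPoint, inner_zero_right, inner_zero_right,
      real_inner_comm]
  rw [fourierLaplace]
  simp only [hsymm]
  rw [← hshift, norm_mul, Complex.norm_real, Real.norm_of_nonneg hc.le]
  have hle : ‖∫ x, Complex.exp (-Complex.I * dotCLM ξ (complexPoint x 0 +
      (-(ε : ℂ) * Complex.I) • complexPoint ξ 0)) *
      F (complexPoint x 0 + (-(ε : ℂ) * Complex.I) • complexPoint ξ 0)‖ ≤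
      ∫ x : EuclideanSpace ℝ (Fin n), N * Real.exp (-(4 * b)⁻¹ * ‖ξ‖ ^ 2) *
        Real.exp (-a * ‖x‖ ^ 2) := by
    refine norm_integral_le_of_norm_le ((integrable_exp_neg_mul_norm_sq ha).const_mul _)
      (Filter.Eventually.of_forall fun x ↦ ?_)
    rw [complexPoint_add_smul, norm_mul, norm_exp_dotCLM]
    simp only [Complex.mul_re, Complex.neg_re, Complex.ofReal_re, Complex.I_re, mul_zero,
      Complex.neg_im, Complex.ofReal_im, neg_zero, Complex.I_im, mul_one, sub_self, zero_smul,
      add_zero, Complex.mul_im, zero_add]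
    rw [real_inner_smul_right, real_inner_self_eq_norm_sq]
    calc Real.exp (-ε * ‖ξ‖ ^ 2) * ‖F (complexPoint x (-ε • ξ))‖
        ≤ Real.exp (-ε * ‖ξ‖ ^ 2) * (N * Real.exp (-a * ‖x‖ ^ 2 + b * ‖-ε • ξ‖ ^ 2)) := by
          gcongr
          exact hbd _ _
      _ = N * Real.exp (-(4 * b)⁻¹ * ‖ξ‖ ^ 2) * Real.exp (-a * ‖x‖ ^ 2) := by
          rw [mul_left_comm, ← Real.exp_add, mul_assoc, ← Real.exp_add, norm_smul, mul_pow,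
            Real.norm_eq_abs, sq_abs, hε]
          congr 2
          field_simp
          ring
  rw [integral_const_mul] at hle
  have h1 := mul_le_mul_of_nonneg_left hle hc.le
  refine h1.trans ?_
  nlinarith [Real.exp_pos (-(4 * b)⁻¹ * ‖ξ‖ ^ 2)]

end Contour

end GaussianDecay

namespace GaussianDecay

variable {n : ℕ}

/-! ### Fourier inversion for tempered distributions. -/

section Inversion

theorem schwartz_fourier_fourier_apply (φ : 𝓢(EuclideanSpace ℝ (Fin n), ℂ))
    (x : EuclideanSpace ℝ (Fin n)) : 𝓕 (𝓕 φ) x = φ (-x) := by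
  have h : 𝓕⁻ (𝓕 φ) = φ := FourierTransform.fourierInv_fourier_eq φ
  conv_rhs => rw [← h]
  rw [SchwartzMap.fourierInv_coe, Real.fourierInv_eq_fourier_neg, neg_neg, ← SchwartzMap.fourier_coe]

theorem schwartzFourier_schwartzFourier_apply (φ : 𝓢(EuclideanSpace ℝ (Fin n), ℂ))
    (x : EuclideanSpace ℝ (Fin n)) : schwartzFourier n (schwartzFourier n φ) x = φ (-x) := by
  have h1 : SchwartzMap.compCLMOfContinuousLinearEquiv ℂ (dilation n).symm (schwartzFourier n φ) =
      (((2 * Real.pi) ^ (-(n : ℝ) / 2) : ℝ) : ℂ) • 𝓕 φ := by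
    ext y
    change (((2 * Real.pi) ^ (-(n : ℝ) / 2) : ℝ) : ℂ) * (𝓕 φ) (dilation n ((dilation n).symm y)) = _
    rw [ContinuousLinearEquiv.apply_symm_apply]
    rfl
  rw [schwartzFourier_eq, h1, FourierTransform.fourier_smul, smul_smul, smul_apply,
    schwartz_fourier_fourier_apply, ← Complex.ofReal_mul]
  have h2 : (2 * Real.pi) ^ (-(n : ℝ) / 2) * (2 * Real.pi) ^ n * (2 * Real.pi) ^ (-(n : ℝ) / 2) =
      1 := by
    rw [← Real.rpow_natCast, ← Real.rpow_add (by positivity), ← Real.rpow_add (by positivity)]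
    ring_nf
    exact Real.rpow_zero _
  rw [h2, Complex.ofReal_one, one_smul]

/-- The inverse transform is therefore the third iterate, so stability under `fourier` already
covers the inverse. -/
theorem fourier_fourier_fourier_fourier
    (u : TemperedDistribution (EuclideanSpace ℝ (Fin n)) ℂ) :
    fourier (fourier (fourier (fourier u))) = u := by
  ext φ
  simp only [fourier_apply]
  congr 1
  ext x
  rw [schwartzFourier_schwartzFourier_apply, schwartzFourier_schwartzFourier_apply, neg_neg]

theorem fourier_injective :
    Function.Injective (fourier : TemperedDistribution (EuclideanSpace ℝ (Fin n)) ℂ → _) := by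
  intro u v h
  rw [← fourier_fourier_fourier_fourier u, h, fourier_fourier_fourier_fourier]

end Inversion

/-! ### Multiplying distributions by Gaussians. -/

section GaussianMultiplication

theorem gaussian_mul_gaussian (c d : ℂ) :
    (gaussian c * gaussian d : EuclideanSpace ℝ (Fin n) → ℂ) = gaussian (c + d) := by
  ext x
  rw [Pi.mul_apply, gaussian, gaussian, gaussian, ← Complex.exp_add, add_mul]

theorem mulGaussian_mulGaussian {c d : ℂ} (hc : c.re ≤ 0) (hd : d.re ≤ 0)
    (u : TemperedDistribution (EuclideanSpace ℝ (Fin n)) ℂ) :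
    mulGaussian d (mulGaussian c u) = mulGaussian (c + d) u := by
  rw [mulGaussian, mulGaussian, TemperedDistribution.smulLeftCLM_smulLeftCLM_apply
    (hasTemperateGrowth_gaussian hc) (hasTemperateGrowth_gaussian hd), gaussian_mul_gaussian,
    mulGaussian]

theorem mulGaussian_zero (u : TemperedDistribution (EuclideanSpace ℝ (Fin n)) ℂ) :
    mulGaussian 0 u = u := by
  have h : (gaussian 0 : EuclideanSpace ℝ (Fin n) → ℂ) = fun _ ↦ 1 := by
    ext x
    simp [gaussian]
  rw [mulGaussian, h, TemperedDistribution.smulLeftCLM_const, one_smul]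

theorem IsFunction.mulGaussian {u : TemperedDistribution (EuclideanSpace ℝ (Fin n)) ℂ}
    {f : EuclideanSpace ℝ (Fin n) → ℂ} (hu : IsFunction u f) {c : ℂ} (hc : c.re ≤ 0) :
    IsFunction (GaussianDecay.mulGaussian c u) fun x ↦ gaussian c x * f x := by
  intro φ
  have h := hu (SchwartzMap.smulLeftCLM ℂ (gaussian c) φ)
  have h1 : (fun x ↦ SchwartzMap.smulLeftCLM ℂ (gaussian c) φ x * f x) =
      fun x ↦ φ x * (gaussian c x * f x) := by
    ext x
    rw [SchwartzMap.smulLeftCLM_apply_apply (hasTemperateGrowth_gaussian hc), smul_eq_mul]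
    ring
  rw [h1] at h
  exact h

end GaussianMultiplication

/-! ### Distributions given by functions, and pointwise decay. -/

section Functions

theorem IsFunction.ae_eq {u : TemperedDistribution (EuclideanSpace ℝ (Fin n)) ℂ}
    {f g : EuclideanSpace ℝ (Fin n) → ℂ} (hf : IsFunction u f) (hg : IsFunction u g)
    (hfl : LocallyIntegrable f) (hgl : LocallyIntegrable g) : f =ᵐ[volume] g := by
  have h := ae_eq_zero_of_integral_contDiff_smul_eq_zero (hfl.sub hgl) fun ψ hψ hψc ↦ ?_
  · filter_upwards [h] with x hx
    exact sub_eq_zero.1 hx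
  · have h1 : HasCompactSupport fun x ↦ (ψ x : ℂ) := hψc.comp_left Complex.ofReal_zero
    have h2 : ContDiff ℝ ∞ fun x ↦ (ψ x : ℂ) := Complex.ofRealCLM.contDiff.comp hψ
    have hf' := hf (h1.toSchwartzMap h2)
    have hg' := hg (h1.toSchwartzMap h2)
    simp only [HasCompactSupport.toSchwartzMap_toFun] at hf' hg'
    have h3 : ∀ x, ψ x • (f - g) x = (ψ x : ℂ) * f x - (ψ x : ℂ) * g x := by
      intro x
      rw [Pi.sub_apply, Complex.real_smul, mul_sub]
    simp only [h3]
    rw [integral_sub hf'.1 hg'.1, ← hf'.2, ← hg'.2, sub_self]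

theorem IsFunction.unique {u v : TemperedDistribution (EuclideanSpace ℝ (Fin n)) ℂ}
    {f : EuclideanSpace ℝ (Fin n) → ℂ} (hu : IsFunction u f) (hv : IsFunction v f) : u = v := by
  ext φ
  rw [(hu φ).2, (hv φ).2]

theorem exists_isFunction {f : EuclideanSpace ℝ (Fin n) → ℂ} (hf : Integrable f) :
    ∃ u : TemperedDistribution (EuclideanSpace ℝ (Fin n)) ℂ, IsFunction u f := by
  have hm : MemLp f 1 := memLp_one_iff_integrable.2 hf
  refine ⟨Lp.toTemperedDistribution (hm.toLp f), fun φ ↦ ⟨?_, ?_⟩⟩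
  · obtain ⟨C, -, hC⟩ := φ.decay 0 0
    refine hf.bdd_mul (c := C) φ.continuous.aestronglyMeasurable
      (Filter.Eventually.of_forall fun x ↦ ?_)
    simpa using hC x
  · rw [Lp.toTemperedDistribution_apply]
    refine integral_congr_ae ?_
    filter_upwards [hm.coeFn_toLp] with x hx
    rw [hx, smul_eq_mul]

/-- A bounded Lipschitz function that decays like a Gaussian in the `L²` sense does so
pointwise. -/
theorem gaussian_decay_of_lipschitz {g : EuclideanSpace ℝ (Fin n) → ℂ} {L B a : ℝ} (ha : 0 < a)
    (hL : ∀ x y, ‖g x - g y‖ ≤ L * ‖x - y‖) (hB : ∀ x, ‖g x‖ ≤ B)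
    (hi : Integrable fun x ↦ Real.exp (a * ‖x‖ ^ 2) * ‖g x‖ ^ 2) :
    ∃ N a' : ℝ, 0 < N ∧ 0 < a' ∧ ∀ x, ‖g x‖ ≤ N * Real.exp (-a' * ‖x‖ ^ 2) := by
  -- As `Λ` dominates `L` and `B`, the ball of radius `ρ = M/(2Λ) ≤ 1` about `x` has `|g| ≥ M/2`.
  -- Its share of `K` bounds `M^(n+2)` by a multiple of `exp (-a|x|²/2)`, and the root of order `n +
  -- 2` gives the rate.
  set Λ := |L| + |B| + 1 with hΛ
  have hΛ0 : 0 < Λ := by positivity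
  set K := ∫ x, Real.exp (a * ‖x‖ ^ 2) * ‖g x‖ ^ 2 with hK
  have hK0 : 0 ≤ K := integral_nonneg fun x ↦ by positivity
  set v := (volume : Measure (EuclideanSpace ℝ (Fin n))).real (Metric.ball 0 1) with hv
  have hv0 : 0 < v :=
    ENNReal.toReal_pos (Metric.measure_ball_pos _ _ one_pos).ne' measure_ball_lt_top.ne
  set C := K * Real.exp a * 4 * (2 * Λ) ^ n / v with hC
  have hC0 : 0 ≤ C := by positivity
  refine ⟨C + 1, a / (2 * (n + 2)), by positivity, by positivity, fun x ↦ ?_⟩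
  rcases eq_or_lt_of_le (norm_nonneg (g x)) with hM | hM
  · rw [← hM]
    positivity
  set M := ‖g x‖ with hMdef
  set ρ := M / (2 * Λ) with hρ
  have hρ0 : 0 < ρ := by positivity
  have hMΛ : M ≤ Λ := (hB x).trans (by rw [hΛ]; linarith [le_abs_self B, abs_nonneg L])
  have hρ1 : ρ ≤ 1 := by
    rw [hρ, div_le_one (by positivity)]
    linarith
  have hlow : ∀ y ∈ Metric.ball x ρ, Real.exp (a / 2 * ‖x‖ ^ 2 - a) * (M / 2) ^ 2 ≤
      Real.exp (a * ‖y‖ ^ 2) * ‖g y‖ ^ 2 := by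
    intro y hy
    rw [mem_ball_iff_norm'] at hy
    have h1 : M / 2 ≤ ‖g y‖ := by
      have h2 : ‖g x - g y‖ ≤ M / 2 := by
        calc ‖g x - g y‖ ≤ L * ‖x - y‖ := hL x y
          _ ≤ Λ * ρ := by
            refine mul_le_mul ?_ hy.le (norm_nonneg _) hΛ0.le
            rw [hΛ]
            linarith [le_abs_self L, abs_nonneg B]
          _ = M / 2 := by rw [hρ]; field_simp
      have h3 := norm_sub_norm_le (g x) (g y)
      linarith
    have h4 : ‖x‖ ≤ ‖y‖ + 1 := by
      have := norm_sub_norm_le x y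
      linarith
    have h5 : ‖x‖ ^ 2 ≤ 2 * ‖y‖ ^ 2 + 2 := by
      have : ‖x‖ ^ 2 ≤ (‖y‖ + 1) ^ 2 := by gcongr
      nlinarith [sq_nonneg (‖y‖ - 1)]
    refine mul_le_mul (Real.exp_le_exp.2 ?_) (by gcongr) (by positivity) (Real.exp_nonneg _)
    nlinarith
  have hint : Real.exp (a / 2 * ‖x‖ ^ 2 - a) * (M / 2) ^ 2 * (ρ ^ n * v) ≤ K := by
    have h1 : (volume : Measure (EuclideanSpace ℝ (Fin n))).real (Metric.ball x ρ) = ρ ^ n * v := by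
      rw [measureReal_def, Measure.addHaar_ball_of_pos _ _ hρ0, ENNReal.toReal_mul,
        ENNReal.toReal_ofReal (by positivity), finrank_euclideanSpace, Fintype.card_fin, hv,
        measureReal_def]
    calc _ = ∫ _ in Metric.ball x ρ, Real.exp (a / 2 * ‖x‖ ^ 2 - a) * (M / 2) ^ 2 := by
          rw [setIntegral_const, h1, smul_eq_mul, mul_comm]
      _ ≤ ∫ y in Metric.ball x ρ, Real.exp (a * ‖y‖ ^ 2) * ‖g y‖ ^ 2 :=
          setIntegral_mono_on (integrableOn_const measure_ball_lt_top.ne) hi.integrableOn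
            measurableSet_ball hlow
      _ ≤ K := setIntegral_le_integral hi (Filter.Eventually.of_forall fun y ↦ by
          simp only [Pi.zero_apply]; positivity)
  have hpow : M ^ (n + 2) ≤ C * Real.exp (-(a / 2) * ‖x‖ ^ 2) := by
    have e1 : Real.exp (a / 2 * ‖x‖ ^ 2 - a) * (M / 2) ^ 2 * (ρ ^ n * v) =
        M ^ (n + 2) * (v / (Real.exp a * 4 * (2 * Λ) ^ n) * Real.exp (a / 2 * ‖x‖ ^ 2)) := by
      rw [hρ, Real.exp_sub, div_pow, div_pow, pow_add]
      field_simp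
      ring
    rw [e1, ← le_div_iff₀ (by positivity)] at hint
    refine hint.trans (le_of_eq ?_)
    rw [hC, neg_mul, Real.exp_neg]
    field_simp
  refine (pow_le_pow_iff_left₀ hM.le (by positivity) (by omega : n + 2 ≠ 0)).1 (hpow.trans ?_)
  rw [mul_pow, ← Real.exp_nat_mul]
  have e2 : ((n + 2 : ℕ) : ℝ) * (-(a / (2 * (n + 2))) * ‖x‖ ^ 2) = -(a / 2) * ‖x‖ ^ 2 := by
    push_cast
    field_simp
  rw [e2]
  gcongr
  calc C ≤ C + 1 := by linarith
    _ ≤ (C + 1) ^ (n + 2) := le_self_pow₀ (by linarith) (by omega)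

end Functions

/-! ### Stability of the class of Gaussian extensions, and criteria for membership. -/

section Extension

variable {F : EuclideanSpace ℂ (Fin n) → ℂ}

theorem continuous_restrict (hF : Differentiable ℂ F) : Continuous fun x ↦ F (complexPoint x 0) :=
  hF.continuous.comp (continuous_complexPoint.comp (continuous_id.prodMk continuous_const))

/-- The bound `|F(x + iy)| ≤ N exp (-a|x|² + b|y|²)` for some `N, a, b > 0`. -/
def GaussianBound (F : EuclideanSpace ℂ (Fin n) → ℂ) : Prop :=
  ∃ N a b : ℝ, 0 < N ∧ 0 < a ∧ 0 < b ∧ ∀ x y : EuclideanSpace ℝ (Fin n),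
    ‖F (complexPoint x y)‖ ≤ N * Real.exp (-a * ‖x‖ ^ 2 + b * ‖y‖ ^ 2)

/-- The factor leaves decay `a - Re c = 2ε`, half of which pays for the cross term in `x·y`. The
rate `a` may have any sign: `a = 0` serves the heat semigroup. -/
theorem gaussianBound_exp_mul {N a b : ℝ} (hN : 0 < N) (hb : 0 < b)
    (hbd : ∀ x y : EuclideanSpace ℝ (Fin n),
      ‖F (complexPoint x y)‖ ≤ N * Real.exp (-a * ‖x‖ ^ 2 + b * ‖y‖ ^ 2))
    {c : ℂ} (hc : c.re < a) : GaussianBound fun z ↦ Complex.exp (c * sumSq z) * F z := by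
  set ε := (a - c.re) / 2 with hε
  have hε0 : 0 < ε := by rw [hε]; linarith
  refine ⟨N, ε, b + |c.re| + c.im ^ 2 / ε, hN, hε0, by positivity, fun x y ↦ ?_⟩
  rw [norm_mul, norm_exp_sumSq]
  refine (mul_le_mul_of_nonneg_left (hbd x y) (Real.exp_nonneg _)).trans ?_
  rw [mul_left_comm, ← Real.exp_add]
  refine mul_le_mul_of_nonneg_left (Real.exp_le_exp.2 ?_) hN.le
  have h1 : -(2 * c.im * inner ℝ x y) ≤ ε * ‖x‖ ^ 2 + c.im ^ 2 / ε * ‖y‖ ^ 2 := by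
    have h2 : -(2 * c.im * inner ℝ x y) ≤ 2 * (|c.im| * (‖x‖ * ‖y‖)) := by
      have h3 : |c.im * inner ℝ x y| ≤ |c.im| * (‖x‖ * ‖y‖) := by
        rw [abs_mul]
        gcongr
        exact abs_real_inner_le_norm x y
      linarith [neg_abs_le (c.im * inner ℝ x y)]
    have h4 : ε * ‖x‖ ^ 2 + c.im ^ 2 / ε * ‖y‖ ^ 2 - 2 * (|c.im| * (‖x‖ * ‖y‖)) =
        (ε * ‖x‖ - |c.im| * ‖y‖) ^ 2 / ε := by
      rw [← sq_abs c.im]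
      field_simp
      ring
    have h5 : 0 ≤ (ε * ‖x‖ - |c.im| * ‖y‖) ^ 2 / ε := by positivity
    linarith
  have h6 : -c.re * ‖y‖ ^ 2 ≤ |c.re| * ‖y‖ ^ 2 := by
    gcongr
    exact neg_le_abs _
  have h7 : a = c.re + 2 * ε := by rw [hε]; ring
  rw [h7]
  nlinarith

theorem GaussianBound.integrable_exp_mul (hF : Differentiable ℂ F) (h : GaussianBound F) :
    ∃ a : ℝ, 0 < a ∧ Integrable (fun x ↦ Real.exp (a * ‖x‖ ^ 2) * ‖F (complexPoint x 0)‖) ∧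
      Integrable (fun x ↦ Real.exp (a * ‖x‖ ^ 2) * ‖F (complexPoint x 0)‖ ^ 2) := by
  obtain ⟨N, a, b, hN, ha, hb, hbd⟩ := h
  have hbd' : ∀ x, ‖F (complexPoint x 0)‖ ≤ N * Real.exp (-a * ‖x‖ ^ 2) := by
    intro x
    simpa using hbd x 0
  have hcont := (continuous_restrict hF).norm
  have hexp : Continuous fun x : EuclideanSpace ℝ (Fin n) ↦ Real.exp (a / 2 * ‖x‖ ^ 2) := by
    fun_prop
  refine ⟨a / 2, half_pos ha, ?_, ?_⟩
  · refine ((integrable_exp_neg_mul_norm_sq (half_pos ha)).const_mul N).mono'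
      (hexp.mul hcont).aestronglyMeasurable (Filter.Eventually.of_forall fun x ↦ ?_)
    rw [Real.norm_of_nonneg (by positivity)]
    calc Real.exp (a / 2 * ‖x‖ ^ 2) * ‖F (complexPoint x 0)‖
        ≤ Real.exp (a / 2 * ‖x‖ ^ 2) * (N * Real.exp (-a * ‖x‖ ^ 2)) := by
          gcongr
          exact hbd' x
      _ = N * Real.exp (-(a / 2) * ‖x‖ ^ 2) := by
          rw [mul_left_comm, ← Real.exp_add]
          ring_nf
  · refine ((integrable_exp_neg_mul_norm_sq (half_pos ha)).const_mul (N ^ 2)).mono'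
      (hexp.mul (hcont.pow 2)).aestronglyMeasurable (Filter.Eventually.of_forall fun x ↦ ?_)
    rw [Real.norm_of_nonneg (by positivity)]
    calc Real.exp (a / 2 * ‖x‖ ^ 2) * ‖F (complexPoint x 0)‖ ^ 2
        ≤ Real.exp (a / 2 * ‖x‖ ^ 2) * (N * Real.exp (-a * ‖x‖ ^ 2)) ^ 2 := by
          gcongr
          exact hbd' x
      _ = N ^ 2 * Real.exp (-(3 * a / 2) * ‖x‖ ^ 2) := by
          rw [mul_pow, mul_left_comm, ← Real.exp_nat_mul, ← Real.exp_add]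
          congr 2
          push_cast
          ring
      _ ≤ N ^ 2 * Real.exp (-(a / 2) * ‖x‖ ^ 2) := by
          refine mul_le_mul_of_nonneg_left (Real.exp_le_exp.2 ?_) (by positivity)
          nlinarith [sq_nonneg ‖x‖]

theorem GaussianBound.integrable (hF : Differentiable ℂ F) (h : GaussianBound F) :
    Integrable fun x ↦ F (complexPoint x 0) := by
  obtain ⟨a, ha, hi, -⟩ := h.integrable_exp_mul hF
  exact integrable_of_exp_mul_norm ha (continuous_restrict hF).aestronglyMeasurable hi

variable {u : TemperedDistribution (EuclideanSpace ℝ (Fin n)) ℂ}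

theorem HasGaussianExtension.memGaussianL2 (h : HasGaussianExtension u) :
    ∃ a : ℝ, 0 < a ∧ MemGaussianL2 a u := by
  obtain ⟨F, hF, hu, hbd⟩ := h
  obtain ⟨a, ha, -, hi⟩ := GaussianBound.integrable_exp_mul hF hbd
  exact ⟨a, ha, _, memLp_two_gaussianWeight_iff.2
    ⟨(continuous_restrict hF).aestronglyMeasurable, hi⟩, hu⟩

theorem hasGaussianExtension_of_real_decay (hF : Differentiable ℂ F)
    (hu : IsFunction u fun x ↦ F (complexPoint x 0))
    (hgrowth : ∃ N b : ℝ, 0 < N ∧ 0 < b ∧ ∀ x y,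
      ‖F (complexPoint x y)‖ ≤ N * Real.exp (b * ‖y‖ ^ 2))
    (hdecay : ∃ N a : ℝ, 0 < N ∧ 0 < a ∧ ∀ x,
      ‖F (complexPoint x 0)‖ ≤ N * Real.exp (-a * ‖x‖ ^ 2)) : HasGaussianExtension u := by
  obtain ⟨N₁, b, hN₁, hb, h₁⟩ := hgrowth
  obtain ⟨N₂, a, hN₂, ha, h₂⟩ := hdecay
  refine ⟨F, hF, hu, gaussian_bound_of_real_decay hF (add_pos hN₁ hN₂) ha hb
    (fun x y ↦ (h₁ x y).trans ?_) fun x ↦ (h₂ x).trans ?_⟩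
  · gcongr
    linarith
  · gcongr
    linarith

theorem HasGaussianExtension.fourier (h : HasGaussianExtension u) :
    HasGaussianExtension (GaussianDecay.fourier u) := by
  obtain ⟨F, hF, hu, hbd⟩ := h
  have hm := (continuous_restrict hF).aestronglyMeasurable (μ := volume)
  obtain ⟨a, ha, hi, -⟩ := GaussianBound.integrable_exp_mul hF hbd
  obtain ⟨N, a', b, hN, ha', hb, hbd⟩ := hbd
  exact hasGaussianExtension_of_real_decay (differentiable_fourierLaplace ha hm hi)
    (hu.fourier ha hm hi) (fourierLaplace_growth ha hm hi)
    (fourierLaplace_decay hF hN ha' hb hbd)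

theorem hasGaussianExtension_fourier_iff :
    HasGaussianExtension (GaussianDecay.fourier u) ↔ HasGaussianExtension u := by
  refine ⟨fun h ↦ ?_, HasGaussianExtension.fourier⟩
  rw [← fourier_fourier_fourier_fourier u]
  exact h.fourier.fourier.fourier

theorem HasGaussianExtension.mulGaussian (h : HasGaussianExtension u) {c : ℂ} (hc : c.re ≤ 0) :
    HasGaussianExtension (GaussianDecay.mulGaussian c u) := by
  obtain ⟨F, hF, hu, N, a, b, hN, ha, hb, hbd⟩ := h
  refine ⟨fun z ↦ Complex.exp (c * sumSq z) * F z,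
    ((differentiable_sumSq.const_mul c).cexp).mul hF, ?_,
    gaussianBound_exp_mul hN hb hbd (hc.trans_lt ha)⟩
  simp only [exp_sumSq_complexPoint_zero]
  exact hu.mulGaussian hc

theorem HasGaussianExtension.expLaplacian (h : HasGaussianExtension u) {z : ℂ} (hz : 0 ≤ z.re) :
    HasGaussianExtension (GaussianDecay.expLaplacian z u) := by
  rw [← hasGaussianExtension_fourier_iff, fourier_expLaplacian hz]
  exact h.fourier.mulGaussian (by simpa using hz)

theorem HasGaussianExtension.hasGaussianDecay (h : HasGaussianExtension u) :
    HasGaussianDecay u := by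
  obtain ⟨b₁, hb₁, h₁⟩ := h.memGaussianL2
  obtain ⟨b₂, hb₂, h₂⟩ := h.fourier.memGaussianL2
  exact ⟨b₁, b₂, hb₁, hb₂, h₁, h₂⟩

/-- The Fourier transform of a function in a Gaussian weighted `L²` space is entire. -/
theorem MemGaussianL2.fourier {a : ℝ} (ha : 0 < a) (h : MemGaussianL2 a u) :
    ∃ F : EuclideanSpace ℂ (Fin n) → ℂ, Differentiable ℂ F ∧
      IsFunction (GaussianDecay.fourier u) (fun x ↦ F (complexPoint x 0)) ∧
      (∃ N b : ℝ, 0 < N ∧ 0 < b ∧ ∀ x y,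
        ‖F (complexPoint x y)‖ ≤ N * Real.exp (b * ‖y‖ ^ 2)) ∧
      ∃ L : ℝ, ∀ x y, ‖F (complexPoint x 0) - F (complexPoint y 0)‖ ≤ L * ‖x - y‖ := by
  obtain ⟨f, hf, hu⟩ := h
  obtain ⟨hm, hi⟩ := memLp_two_gaussianWeight_iff.1 hf
  have hi' := integrable_exp_mul_norm_of_sq ha hm hi
  have ha' : 0 < a / 4 := by positivity
  exact ⟨fourierLaplace f, differentiable_fourierLaplace ha' hm hi', hu.fourier ha' hm hi',
    fourierLaplace_growth ha' hm hi', fourierLaplace_lipschitz ha' hm hi'⟩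

/-- Decay of `u` makes its transform entire, of Gaussian growth and Lipschitz on `ℝⁿ`; the `L²`
decay of the transform then becomes pointwise, and the maximum principle applies. -/
theorem HasGaussianDecay.hasGaussianExtension (h : HasGaussianDecay u) :
    HasGaussianExtension u := by
  obtain ⟨b₁, b₂, hb₁, hb₂, h₁, g, hg, hug⟩ := h
  obtain ⟨F, hF, huF, hgrowth, L, hL⟩ := h₁.fourier hb₁
  obtain ⟨hgm, hgi⟩ := memLp_two_gaussianWeight_iff.1 hg
  have hgl : Integrable g := integrable_of_exp_mul_norm (by positivity : 0 < b₂ / 4) hgm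
    (integrable_exp_mul_norm_of_sq hb₂ hgm hgi)
  have hae := hug.ae_eq huF hgl.locallyIntegrable (continuous_restrict hF).locallyIntegrable
  have hFi : Integrable fun x ↦ Real.exp (b₂ * ‖x‖ ^ 2) * ‖F (complexPoint x 0)‖ ^ 2 := by
    refine hgi.congr ?_
    filter_upwards [hae] with x hx
    rw [hx]
  rw [← hasGaussianExtension_fourier_iff]
  refine hasGaussianExtension_of_real_decay hF huF hgrowth ?_
  obtain ⟨N, b, -, -, hN⟩ := hgrowth
  exact gaussian_decay_of_lipschitz hb₂ hL (B := N) (fun x ↦ by simpa using hN x 0) hFi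

theorem hasGaussianExtension_of_schrodinger {t₁ t₂ : ℝ} (ht : t₁ ≠ t₂) {a₁ a₂ : ℝ} (ha₁ : 0 < a₁)
    (ha₂ : 0 < a₂) (h₁ : MemGaussianL2 a₁ (GaussianDecay.expLaplacian (Complex.I * t₁) u))
    (h₂ : MemGaussianL2 a₂ (GaussianDecay.expLaplacian (Complex.I * t₂) u)) :
    HasGaussianExtension u := by
  obtain ⟨F, hF, huF, hFg, -⟩ := h₁.fourier ha₁
  obtain ⟨G, hG, huG, hGg, -⟩ := h₂.fourier ha₂
  set v := GaussianDecay.expLaplacian (Complex.I * t₁) u with hv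
  have hre : ∀ t : ℝ, (Complex.I * t).re = 0 := fun t ↦ by simp
  have hv' : GaussianDecay.fourier v =
      GaussianDecay.mulGaussian (-(Complex.I * t₁)) (GaussianDecay.fourier u) :=
    fourier_expLaplacian (hre t₁).ge u
  have hu : GaussianDecay.fourier u =
      GaussianDecay.mulGaussian (Complex.I * t₁) (GaussianDecay.fourier v) := by
    rw [hv', mulGaussian_mulGaussian (by simp) (hre t₁).le, neg_add_cancel, mulGaussian_zero]
  have hw : GaussianDecay.fourier (GaussianDecay.expLaplacian (Complex.I * t₂) u) =
      GaussianDecay.mulGaussian (Complex.I * ((t₁ - t₂ : ℝ) : ℂ)) (GaussianDecay.fourier v) := by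
    rw [fourier_expLaplacian (hre t₂).ge, hu, mulGaussian_mulGaussian (hre t₁).le (by simp)]
    congr 1
    push_cast
    ring
  have hE : Differentiable ℂ fun z : EuclideanSpace ℂ (Fin n) ↦
      Complex.exp (Complex.I * ((t₁ - t₂ : ℝ) : ℂ) * sumSq z) * F z :=
    ((differentiable_sumSq.const_mul _).cexp).mul hF
  -- The chirp relation holds between distributions, hence pointwise on `ℝⁿ` by continuity, hence on
  -- `ℂⁿ`, where the growth of `G` bounds the chirped `F`.
  have hGF : G = fun z ↦ Complex.exp (Complex.I * ((t₁ - t₂ : ℝ) : ℂ) * sumSq z) * F z := by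
    refine eq_of_eqOn_real hG hE fun x ↦ ?_
    rw [hw] at huG
    have hvF := huF.mulGaussian (hre (t₁ - t₂)).le
    simp only [← exp_sumSq_complexPoint_zero] at hvF
    have hae := huG.ae_eq hvF (continuous_restrict hG).locallyIntegrable
      (continuous_restrict hE).locallyIntegrable
    exact congrFun ((Continuous.ae_eq_iff_eq volume (continuous_restrict hG)
      (continuous_restrict hE)).1 hae) x
  have hext : HasGaussianExtension (GaussianDecay.fourier v) := by
    refine hasGaussianExtension_of_real_decay hF huF hFg ?_
    obtain ⟨N₁, b₁, hN₁, hb₁, hF'⟩ := hFg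
    obtain ⟨N₂, b₂, hN₂, hb₂, hG'⟩ := hGg
    rw [hGF] at hG'
    obtain ⟨a, ha, hdec⟩ := real_decay_of_chirp_bound (N := N₁ + N₂) (b := b₁ + b₂) hF
      (by positivity) (sub_ne_zero.2 ht) (by positivity)
      (fun x y ↦ (hF' x y).trans (by gcongr <;> linarith))
      (fun x y ↦ (hG' x y).trans (by gcongr <;> linarith))
    exact ⟨N₁ + N₂, a, by positivity, ha, hdec⟩
  rw [← hasGaussianExtension_fourier_iff, hu]
  exact hext.mulGaussian (hre t₁).le

theorem hasGaussianExtension_of_heat {δ ε : ℝ} (hδ : 0 < δ) (hε : 0 < ε)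
    (h : MemGaussianL2 ε u) :
    HasGaussianExtension (GaussianDecay.expLaplacian (δ : ℂ) u) := by
  obtain ⟨F, hF, huF, ⟨N, b, hN, hb, hgrowth⟩, -⟩ := h.fourier hε
  rw [← hasGaussianExtension_fourier_iff, fourier_expLaplacian (by simpa using hδ.le)]
  have hc : (-(δ : ℂ)).re < 0 := by simpa using hδ
  refine ⟨fun z ↦ Complex.exp (-(δ : ℂ) * sumSq z) * F z,
    ((differentiable_sumSq.const_mul _).cexp).mul hF, ?_,
    gaussianBound_exp_mul (a := 0) hN hb (by simpa using hgrowth) hc⟩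
  simp only [exp_sumSq_complexPoint_zero]
  exact huF.mulGaussian hc.le

/-- Half of the decay of the transform can be given up: multiplying it by `exp (a z²/2)` stays in
the class, and the inverse transform of the product is the required initial datum. -/
theorem HasGaussianExtension.exists_heat (h : HasGaussianExtension u) :
    ∃ δ ε : ℝ, 0 < δ ∧ 0 < ε ∧ ∃ h : TemperedDistribution (EuclideanSpace ℝ (Fin n)) ℂ,
      MemGaussianL2 ε h ∧ u = GaussianDecay.expLaplacian (δ : ℂ) h := by
  obtain ⟨F, hF, huF, N, a, b, hN, ha, hb, hbd⟩ := h.fourier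
  have hδ : 0 < a / 2 := half_pos ha
  have hG : Differentiable ℂ fun z : EuclideanSpace ℂ (Fin n) ↦
      Complex.exp (((a / 2 : ℝ) : ℂ) * sumSq z) * F z :=
    ((differentiable_sumSq.const_mul _).cexp).mul hF
  have hGb := gaussianBound_exp_mul hN hb hbd (c := ((a / 2 : ℝ) : ℂ))
    (by rw [Complex.ofReal_re]; linarith)
  -- The weight grows, so the product is formed as a function and only then regarded as a
  -- distribution.
  obtain ⟨k, hk⟩ := exists_isFunction (hGb.integrable hG)
  have hkE : HasGaussianExtension k := ⟨_, hG, hk, hGb⟩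
  obtain ⟨ε, hε, hmem⟩ := hkE.fourier.fourier.fourier.memGaussianL2
  refine ⟨a / 2, ε, hδ, hε, _, hmem, fourier_injective ?_⟩
  rw [fourier_expLaplacian (by rw [Complex.ofReal_re]; exact hδ.le),
    fourier_fourier_fourier_fourier]
  refine huF.unique ?_
  have := hk.mulGaussian (c := -((a / 2 : ℝ) : ℂ)) (by simpa using hδ.le)
  convert! this using 2 with x
  rw [exp_sumSq_complexPoint_zero, ← mul_assoc, ← Pi.mul_apply, gaussian_mul_gaussian,
    neg_add_cancel]
  simp [gaussian]

end Extension

end GaussianDecay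

/-! ### Assembling the equivalences around (v). -/

theorem theorem1p1 (n : ℕ) (u₀ : TemperedDistribution (EuclideanSpace ℝ (Fin n)) ℂ) (τ : ℝ) :
    List.TFAE [
      (∃ t₁ t₂ : ℝ, t₁ ≠ t₂ ∧ ∃ a₁ a₂ : ℝ, 0 < a₁ ∧ 0 < a₂ ∧
        GaussianDecay.MemGaussianL2 a₁ (GaussianDecay.expLaplacian (Complex.I * t₁) u₀) ∧
        GaussianDecay.MemGaussianL2 a₂ (GaussianDecay.expLaplacian (Complex.I * t₂) u₀)),
      GaussianDecay.HasGaussianDecay u₀,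
      (∃ ν : ℝ≥0 → ℝ, (∀ t, 0 < ν t) ∧ ∀ t : ℝ≥0,
        GaussianDecay.MemGaussianL2 (ν t)
          (GaussianDecay.expLaplacian (Complex.I * ((t : ℝ) : ℂ)) u₀)),
      GaussianDecay.HasGaussianDecay (GaussianDecay.mulGaussian (Complex.I * τ) u₀),
      GaussianDecay.HasGaussianExtension u₀,
      GaussianDecay.HasGaussianExtension (GaussianDecay.fourier u₀),
      (∃ δ ε : ℝ, 0 < δ ∧ 0 < ε ∧
        ∃ h : TemperedDistribution (EuclideanSpace ℝ (Fin n)) ℂ,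
          GaussianDecay.MemGaussianL2 ε h ∧ u₀ = GaussianDecay.expLaplacian (δ : ℂ) h)] := by
  have hre : ∀ t : ℝ, (Complex.I * t).re = 0 := fun t ↦ by simp
  tfae_have 1 → 5 := by
    rintro ⟨t₁, t₂, ht, a₁, a₂, ha₁, ha₂, h₁, h₂⟩
    exact GaussianDecay.hasGaussianExtension_of_schrodinger ht ha₁ ha₂ h₁ h₂
  tfae_have 2 → 5 := GaussianDecay.HasGaussianDecay.hasGaussianExtension
  tfae_have 5 → 2 := GaussianDecay.HasGaussianExtension.hasGaussianDecay
  tfae_have 5 → 3 := by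
    intro h
    have h' : ∀ t : ℝ≥0, ∃ a : ℝ, 0 < a ∧ GaussianDecay.MemGaussianL2 a
        (GaussianDecay.expLaplacian (Complex.I * ((t : ℝ) : ℂ)) u₀) := fun t ↦
      (h.expLaplacian (hre t).ge).memGaussianL2
    choose ν hν hmem using h'
    exact ⟨ν, hν, hmem⟩
  tfae_have 3 → 1 := by
    rintro ⟨ν, hν, hmem⟩
    exact ⟨((0 : ℝ≥0) : ℝ), ((1 : ℝ≥0) : ℝ), by simp, ν 0, ν 1, hν 0, hν 1, hmem 0, hmem 1⟩
  tfae_have 5 → 4 := fun h ↦ (h.mulGaussian (hre τ).le).hasGaussianDecay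
  tfae_have 4 → 5 := by
    intro h
    have h' := h.hasGaussianExtension.mulGaussian (c := -(Complex.I * τ)) (by simp)
    rwa [GaussianDecay.mulGaussian_mulGaussian (hre τ).le (by simp), add_neg_cancel,
      GaussianDecay.mulGaussian_zero] at h'
  tfae_have 6 ↔ 5 := GaussianDecay.hasGaussianExtension_fourier_iff
  tfae_have 5 → 7 := GaussianDecay.HasGaussianExtension.exists_heat
  tfae_have 7 → 5 := by
    rintro ⟨δ, ε, hδ, hε, h, hmem, rfl⟩
    exact GaussianDecay.hasGaussianExtension_of_heat hδ hε hmem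
  tfae_finish
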